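/- Rings are associative but need not be commutative or have an identity. A ring $R$ is \emph{nil} if every element of $R$ is nilpotent, and \emph{prime} if for all $a,b\in R$, $aRb=0$ implies $a=0$ or $b=0$. A right ideal $J$ of $R$ is \emph{dense} if for all $a,b\in R$ with $a\neq 0$ there is $r\in R$ with $ar\neq 0$ and $br\in J$. For a prime ring $R$, the \emph{maximal right ring of quotients} $Q$ of $R$ is the ring of classes $[f;J]$ of right $R$-module homomorphisms $f\colon J\to R$ defined on dense right ideals $J$, where $[f;J]=[g;K]$ if $f$ and $g$ agree on some dense right ideal contained in $J\cap K$; addition is that of homomorphisms, multiplication is composition (on the dense right ideals where it is defined), and $a\in R$ is identified with the class of left multiplication by $a$. The \emph{extended centroid} $C$ of $R$ is the center of $Q$. For $c_1,\dots,c_n\in C$, let $R[c_1,\dots,c_n]\subseteq Q$ denote the subring of all finite sums $\sum_\alpha a_\alpha c_1^{\alpha_1}\cdots c_n^{\alpha_n}$ with $a_\alpha\in R$ and $\alpha=(\alpha_1,\dots,\alpha_n)$ an $n$-tuple of non-negative integers. \textbf{Theorem.} Let $R$ be a prime nil ring with extended centroid $C$, and let $c_1,\dots,c_n\in C$, $n\ge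 1$, be such that $S=R[c_1,\dots,c_n]$ is a simple ring (that is, $S\neq 0$ and the only two-sided ideals of $S$ are $0$ and $S$). Then the center of $S$ is zero; in particular, $S$ has no identity element. -/

import Mathlib

/-- A (not necessarily unital, not necessarily commutative) ring `R` is *prime* if
`a R b = 0` implies `a = 0` or `b = 0`. -/
class IsPrimeRing (R : Type*) [NonUnitalRing R] : Prop where
  eq_zero_or_eq_zero : ∀ a b : R, (∀ r : R, a * r * b = 0) → a = 0 ∨ b = 0

/-- `powSucc a k` is the power `a ^ (k + 1)` in a ring that need not have an identity. -/
def powSucc {R : Type*} [NonUnitalRing R] (a : R) : ℕ → R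
  | 0 => a
  | k + 1 => powSucc a k * a

/-- A ring is *nil* if every element has some positive power equal to zero. -/
def IsNilRing (R : Type*) [NonUnitalRing R] : Prop :=
  ∀ a : R, ∃ k : ℕ, powSucc a k = 0

/-- `J` is a *dense right ideal* of `R`: a right ideal such that for all `a ≠ 0` and `b` in `R`
there is an `r` in `R` with `a r ≠ 0` and `b r ∈ J`. -/
structure IsDenseRightIdeal {R : Type*} [NonUnitalRing R] (J : AddSubgroup R) : Prop where
  mul_mem : ∀ x ∈ J, ∀ r : R, x * r ∈ J
  dense : ∀ a b : R, a ≠ 0 → ∃ r : R, a * r ≠ 0 ∧ b * r ∈ J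

namespace IsDenseRightIdeal

variable {R : Type*} [NonUnitalRing R]

theorem inf {J K : AddSubgroup R} (hJ : IsDenseRightIdeal J) (hK : IsDenseRightIdeal K) :
    IsDenseRightIdeal (J ⊓ K) where
  mul_mem x hx r := ⟨hJ.mul_mem x hx.1 r, hK.mul_mem x hx.2 r⟩
  dense a b ha := by
    obtain ⟨r, hr, hbr⟩ := hJ.dense a b ha
    obtain ⟨s, hs, hbs⟩ := hK.dense (a * r) (b * r) hr
    refine ⟨r * s, by rwa [← mul_assoc], ?_⟩
    rw [← mul_assoc]
    exact ⟨hJ.mul_mem _ hbr s, hbs⟩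

theorem top [IsPrimeRing R] : IsDenseRightIdeal (⊤ : AddSubgroup R) where
  mul_mem _ _ _ := AddSubgroup.mem_top _
  dense a b ha := by
    by_contra! h
    have h0 : ∀ r : R, a * r = 0 := fun r => by
      by_contra hr
      exact h r hr (AddSubgroup.mem_top _)
    rcases IsPrimeRing.eq_zero_or_eq_zero a a (fun r => by rw [h0, zero_mul]) with h1 | h1 <;>
      exact ha h1

end IsDenseRightIdeal

/-- A pair `(f, J)`, where `J` is a dense right ideal of `R` and `f : J → R` is a homomorphism of
right `R`-modules. -/
structure DensePartialHom (R : Type*) [NonUnitalRing R] where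
  dom : AddSubgroup R
  isDense : IsDenseRightIdeal dom
  toHom : dom →+ R
  map_mul : ∀ (x : dom) (r : R),
    toHom ⟨(x : R) * r, isDense.mul_mem x x.2 r⟩ = toHom x * r

namespace DensePartialHom

variable {R : Type*} [NonUnitalRing R]

/-- `(f, J)` and `(g, K)` are equivalent if `f` and `g` agree on some dense right ideal
`L ⊆ J ∩ K`. -/
def Equiv (f g : DensePartialHom R) : Prop :=
  ∃ L : AddSubgroup R, IsDenseRightIdeal L ∧
    ∀ x ∈ L, ∃ (hf : x ∈ f.dom) (hg : x ∈ g.dom), f.toHom ⟨x, hf⟩ = g.toHom ⟨x, hg⟩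

theorem equiv_of_agree {f g : DensePartialHom R}
    (h : ∀ (x : R) (hf : x ∈ f.dom) (hg : x ∈ g.dom), f.toHom ⟨x, hf⟩ = g.toHom ⟨x, hg⟩) :
    Equiv f g :=
  ⟨f.dom ⊓ g.dom, f.isDense.inf g.isDense, fun x hx => ⟨hx.1, hx.2, h x hx.1 hx.2⟩⟩

instance setoid (R : Type*) [NonUnitalRing R] : Setoid (DensePartialHom R) where
  r := Equiv
  iseqv :=
    { refl := fun _ => equiv_of_agree fun _ _ _ => rfl
      symm := fun ⟨L, hL, h⟩ => ⟨L, hL, fun x hx => by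
        obtain ⟨h1, h2, h3⟩ := h x hx
        exact ⟨h2, h1, h3.symm⟩⟩
      trans := fun ⟨L, hL, h⟩ ⟨M, hM, k⟩ => ⟨L ⊓ M, hL.inf hM, fun x hx => by
        obtain ⟨h1, _, h3⟩ := h x hx.1
        obtain ⟨_, k2, k3⟩ := k x hx.2
        exact ⟨h1, k2, h3.trans k3⟩⟩ }

/-- The sum `(f + g, J ∩ K)`. -/
def add (f g : DensePartialHom R) : DensePartialHom R where
  dom := f.dom ⊓ g.dom
  isDense := f.isDense.inf g.isDense
  toHom := f.toHom.comp (AddSubgroup.inclusion inf_le_left) +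
    g.toHom.comp (AddSubgroup.inclusion inf_le_right)
  map_mul x r := by
    have h1 := f.map_mul ⟨x, x.2.1⟩ r
    have h2 := g.map_mul ⟨x, x.2.2⟩ r
    change f.toHom ⟨x * r, _⟩ + g.toHom ⟨x * r, _⟩ = (f.toHom ⟨x, _⟩ + g.toHom ⟨x, _⟩) * r
    rw [add_mul, ← h1, ← h2]

/-- The negative `(-f, J)`. -/
def neg (f : DensePartialHom R) : DensePartialHom R where
  dom := f.dom
  isDense := f.isDense
  toHom := -f.toHom
  map_mul x r := by
    change -f.toHom _ = -f.toHom x * r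
    rw [f.map_mul, neg_mul]

/-- The product `(f ∘ g, g⁻¹(J))` of `(f, J)` and `(g, K)`. -/
def mul (f g : DensePartialHom R) : DensePartialHom R where
  dom := (f.dom.comap g.toHom).map g.dom.subtype
  isDense :=
    { mul_mem := by
        rintro _ ⟨x, hx, rfl⟩ r
        refine ⟨⟨x * r, g.isDense.mul_mem x x.2 r⟩, ?_, rfl⟩
        change g.toHom _ ∈ f.dom
        rw [g.map_mul]
        exact f.isDense.mul_mem _ hx r
      dense := fun a b ha => by
        obtain ⟨r, hr, hbr⟩ := g.isDense.dense a b ha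
        obtain ⟨s, hs, hbs⟩ := f.isDense.dense (a * r) (g.toHom ⟨b * r, hbr⟩) hr
        refine ⟨r * s, by rwa [← mul_assoc], ⟨⟨b * r * s, g.isDense.mul_mem _ hbr s⟩, ?_, ?_⟩⟩
        · change g.toHom _ ∈ f.dom
          rw [g.map_mul ⟨b * r, hbr⟩ s]
          exact hbs
        · exact mul_assoc b r s }
  toHom :=
    { toFun := fun x => f.toHom ⟨g.toHom ⟨x, by obtain ⟨y, _, h⟩ := x.2; exact h ▸ y.2⟩, by
        obtain ⟨y, hy, h⟩ := x.2
        have : (⟨x, h ▸ y.2⟩ : g.dom) = y := Subtype.ext h.symm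
        rw [this]
        exact hy⟩
      map_zero' := by
        rw [← map_zero f.toHom]
        congr 1
        exact Subtype.ext (map_zero g.toHom)
      map_add' := fun x y => by
        rw [← map_add f.toHom]
        congr 1
        exact Subtype.ext (map_add g.toHom ⟨x, _⟩ ⟨y, _⟩) }
  map_mul x r := by
    have h : ∀ (z : f.dom), f.toHom z * r = f.toHom ⟨z * r, f.isDense.mul_mem z z.2 r⟩ :=
      fun z => (f.map_mul z r).symm
    change f.toHom _ = f.toHom _ * r
    rw [h]
    congr 1
    exact Subtype.ext (g.map_mul ⟨x, _⟩ r)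

theorem mem_mul_dom {f g : DensePartialHom R} {x : R} :
    x ∈ (mul f g).dom ↔ ∃ hx : x ∈ g.dom, g.toHom ⟨x, hx⟩ ∈ f.dom := by
  constructor
  · rintro ⟨y, hy, rfl⟩
    exact ⟨y.2, hy⟩
  · rintro ⟨hx, h⟩
    exact ⟨⟨x, hx⟩, h, rfl⟩

/-- Left multiplication by `a`, as a homomorphism of right modules defined on all of `R`. -/
def ofElem [IsPrimeRing R] (a : R) : DensePartialHom R where
  dom := ⊤
  isDense := IsDenseRightIdeal.top
  toHom := (AddMonoidHom.mulLeft a).comp (AddSubgroup.subtype ⊤)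
  map_mul x r := (mul_assoc a (x : R) r).symm

/-- The identity homomorphism `R → R`. -/
def one [IsPrimeRing R] : DensePartialHom R where
  dom := ⊤
  isDense := IsDenseRightIdeal.top
  toHom := AddSubgroup.subtype ⊤
  map_mul _ _ := rfl

theorem add_equiv {f f' g g' : DensePartialHom R} (hf : Equiv f f') (hg : Equiv g g') :
    Equiv (add f g) (add f' g') := by
  obtain ⟨L, hL, h⟩ := hf
  obtain ⟨M, hM, k⟩ := hg
  refine ⟨L ⊓ M, hL.inf hM, fun x hx => ?_⟩
  obtain ⟨h1, h2, h3⟩ := h x hx.1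
  obtain ⟨k1, k2, k3⟩ := k x hx.2
  exact ⟨⟨h1, k1⟩, ⟨h2, k2⟩, congrArg₂ (· + ·) h3 k3⟩

theorem neg_equiv {f f' : DensePartialHom R} (hf : Equiv f f') : Equiv (neg f) (neg f') := by
  obtain ⟨L, hL, h⟩ := hf
  refine ⟨L, hL, fun x hx => ?_⟩
  obtain ⟨h1, h2, h3⟩ := h x hx
  exact ⟨h1, h2, congrArg (fun y => -y) h3⟩

theorem mul_equiv {f f' g g' : DensePartialHom R} (hf : Equiv f f') (hg : Equiv g g') :
    Equiv (mul f g) (mul f' g') := by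
  obtain ⟨L, hL, h⟩ := hf
  obtain ⟨M, hM, k⟩ := hg
  have hk : ∀ x ∈ M, ∃ hx : x ∈ g.dom, ∃ hx' : x ∈ g'.dom,
      g.toHom ⟨x, hx⟩ = g'.toHom ⟨x, hx'⟩ := k
  let N : AddSubgroup R := ((L.comap g.toHom).map g.dom.subtype) ⊓ M
  have hN : ∀ x, x ∈ N ↔ (∃ hx : x ∈ g.dom, g.toHom ⟨x, hx⟩ ∈ L) ∧ x ∈ M := fun x => by
    constructor
    · rintro ⟨⟨y, hy, rfl⟩, hM⟩
      exact ⟨⟨y.2, hy⟩, hM⟩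
    · rintro ⟨⟨hx, h⟩, hM⟩
      exact ⟨⟨⟨x, hx⟩, h, rfl⟩, hM⟩
  refine ⟨N, ⟨fun x hx r => ?_, fun a b ha => ?_⟩, fun x hx => ?_⟩
  · obtain ⟨⟨h1, h2⟩, h3⟩ := (hN x).1 hx
    refine (hN _).2 ⟨⟨g.isDense.mul_mem x h1 r, ?_⟩, hM.mul_mem x h3 r⟩
    rw [g.map_mul ⟨x, h1⟩ r]
    exact hL.mul_mem _ h2 r
  · obtain ⟨r, hr, hbr⟩ := hM.dense a b ha
    obtain ⟨hg1, _, _⟩ := k _ hbr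
    obtain ⟨s, hs, hbs⟩ := hL.dense (a * r) (g.toHom ⟨b * r, hg1⟩) hr
    refine ⟨r * s, by rwa [← mul_assoc], ?_⟩
    rw [← mul_assoc]
    refine (hN _).2 ⟨⟨g.isDense.mul_mem _ hg1 s, ?_⟩, hM.mul_mem _ hbr s⟩
    rw [g.map_mul ⟨b * r, hg1⟩ s]
    exact hbs
  · obtain ⟨⟨h1, h2⟩, h3⟩ := (hN x).1 hx
    obtain ⟨_, k2, k3⟩ := k x h3
    obtain ⟨l1, l2, l3⟩ := h _ h2
    refine ⟨mem_mul_dom.2 ⟨h1, l1⟩, mem_mul_dom.2 ⟨k2, k3 ▸ l2⟩, ?_⟩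
    change f.toHom ⟨g.toHom ⟨x, _⟩, _⟩ = f'.toHom ⟨g'.toHom ⟨x, _⟩, _⟩
    rw [l3]
    congr 1
    exact Subtype.ext k3

end DensePartialHom

/-- The maximal right ring of quotients of a prime ring `R`: the direct limit of the groups
`Hom (J_R, R_R)` over all dense right ideals `J` of `R`. -/
def MaxRightQuotientRing (R : Type*) [NonUnitalRing R] [IsPrimeRing R] : Type _ :=
  Quotient (DensePartialHom.setoid R)

namespace MaxRightQuotientRing

open DensePartialHom

variable {R : Type*} [NonUnitalRing R] [IsPrimeRing R]

/-- The class `[f; J]` of a pair `(f, J)`. -/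
def mk (f : DensePartialHom R) : MaxRightQuotientRing R := Quotient.mk _ f

theorem mk_eq_of_agree {f g : DensePartialHom R}
    (h : ∀ (x : R) (hf : x ∈ f.dom) (hg : x ∈ g.dom), f.toHom ⟨x, hf⟩ = g.toHom ⟨x, hg⟩) :
    mk f = mk g :=
  Quotient.sound (equiv_of_agree h)

instance : Zero (MaxRightQuotientRing R) := ⟨mk (ofElem 0)⟩

instance : One (MaxRightQuotientRing R) := ⟨mk one⟩

instance : Add (MaxRightQuotientRing R) :=
  ⟨Quotient.map₂ add fun _ _ h _ _ k => add_equiv h k⟩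

instance : Neg (MaxRightQuotientRing R) :=
  ⟨Quotient.map neg fun _ _ h => neg_equiv h⟩

instance : Mul (MaxRightQuotientRing R) :=
  ⟨Quotient.map₂ mul fun _ _ h _ _ k => mul_equiv h k⟩

/-- Addition is addition of homomorphisms, multiplication is composition, and the identity is the
class of the identity homomorphism. -/
instance : Ring (MaxRightQuotientRing R) where
  add_assoc := by
    rintro ⟨f⟩ ⟨g⟩ ⟨h⟩
    exact mk_eq_of_agree fun x _ _ => add_assoc (f.toHom ⟨x, _⟩) (g.toHom ⟨x, _⟩) (h.toHom ⟨x, _⟩)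
  zero_add := by
    rintro ⟨f⟩
    refine mk_eq_of_agree fun x _ _ => ?_
    change 0 * x + f.toHom ⟨x, _⟩ = _
    rw [zero_mul, zero_add]
  add_zero := by
    rintro ⟨f⟩
    refine mk_eq_of_agree fun x _ _ => ?_
    change f.toHom ⟨x, _⟩ + 0 * x = _
    rw [zero_mul, add_zero]
  add_comm := by
    rintro ⟨f⟩ ⟨g⟩
    exact mk_eq_of_agree fun x _ _ => add_comm (f.toHom ⟨x, _⟩) (g.toHom ⟨x, _⟩)
  neg_add_cancel := by
    rintro ⟨f⟩
    refine mk_eq_of_agree fun x _ _ => ?_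
    change -f.toHom ⟨x, _⟩ + f.toHom ⟨x, _⟩ = 0 * x
    rw [zero_mul, neg_add_cancel]
  mul_assoc := by
    rintro ⟨f⟩ ⟨g⟩ ⟨h⟩
    exact mk_eq_of_agree fun _ _ _ => rfl
  one_mul := by
    rintro ⟨f⟩
    exact mk_eq_of_agree fun _ _ _ => rfl
  mul_one := by
    rintro ⟨f⟩
    exact mk_eq_of_agree fun _ _ _ => rfl
  zero_mul := by
    rintro ⟨f⟩
    refine mk_eq_of_agree fun x _ _ => ?_
    change 0 * f.toHom ⟨x, _⟩ = 0 * x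
    rw [zero_mul, zero_mul]
  mul_zero := by
    rintro ⟨f⟩
    refine mk_eq_of_agree fun x _ h => ?_
    change f.toHom ⟨0 * x, _⟩ = 0 * x
    have h0 : f.toHom 0 = 0 * x := by rw [map_zero, zero_mul]
    refine Eq.trans ?_ h0
    congr 1
    exact Subtype.ext (zero_mul x)
  left_distrib := by
    rintro ⟨f⟩ ⟨g⟩ ⟨h⟩
    refine mk_eq_of_agree fun x _ _ => ?_
    change f.toHom ⟨g.toHom ⟨x, _⟩ + h.toHom ⟨x, _⟩, _⟩ =
      f.toHom ⟨g.toHom ⟨x, _⟩, _⟩ + f.toHom ⟨h.toHom ⟨x, _⟩, _⟩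
    rw [← map_add]
    rfl
  right_distrib := by
    rintro ⟨f⟩ ⟨g⟩ ⟨h⟩
    exact mk_eq_of_agree fun _ _ _ => rfl
  nsmul := nsmulRec
  zsmul := zsmulRec

/-- The canonical embedding of `R` into its maximal right ring of quotients; it sends `a` to the
class of left multiplication by `a`. -/
def of (R : Type*) [NonUnitalRing R] [IsPrimeRing R] : R →ₙ+* MaxRightQuotientRing R where
  toFun a := mk (ofElem a)
  map_zero' := rfl
  map_add' a b := mk_eq_of_agree fun x _ _ => add_mul a b x
  map_mul' a b := mk_eq_of_agree fun x _ _ => mul_assoc a b x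

end MaxRightQuotientRing

/-- The extended centroid of a prime ring: the center of its maximal right ring of quotients. -/
abbrev ExtendedCentroid (R : Type*) [NonUnitalRing R] [IsPrimeRing R] :
    Subring (MaxRightQuotientRing R) :=
  Subring.center (MaxRightQuotientRing R)

section PolynomialExpressions

variable {R : Type*} [NonUnitalRing R] [IsPrimeRing R] {n : ℕ}

/-- The monomial `c₁ ^ α₁ ⋯ cₙ ^ αₙ`. -/
def centroidMonomial (c : Fin n → ExtendedCentroid R) (α : Fin n → ℕ) : MaxRightQuotientRing R :=
  ((∏ i, c i ^ α i : ExtendedCentroid R) : MaxRightQuotientRing R)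

/-- The value `∑ a_α c₁ ^ α₁ ⋯ cₙ ^ αₙ` of the polynomial with coefficients `a_α ∈ R`. -/
noncomputable def polyValue (c : Fin n → ExtendedCentroid R) :
    ((Fin n → ℕ) →₀ R) →+ MaxRightQuotientRing R :=
  Finsupp.liftAddHom fun α =>
    (AddMonoidHom.mulRight (centroidMonomial c α)).comp
      (MaxRightQuotientRing.of R : R →+ MaxRightQuotientRing R)

theorem polyValue_single (c : Fin n → ExtendedCentroid R) (α : Fin n → ℕ) (a : R) :
    polyValue c (Finsupp.single α a) = MaxRightQuotientRing.of R a * centroidMonomial c α := by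
  simp [polyValue]

theorem polyValue_single_mul (c : Fin n → ExtendedCentroid R) (α β : Fin n → ℕ) (a b : R) :
    polyValue c (Finsupp.single α a) * polyValue c (Finsupp.single β b) =
      polyValue c (Finsupp.single (α + β) (a * b)) := by
  have h : centroidMonomial c (α + β) = centroidMonomial c α * centroidMonomial c β := by
    simp only [centroidMonomial, Pi.add_apply, pow_add, Finset.prod_mul_distrib]
    rfl
  have hc := Subring.mem_center_iff.1 (∏ i, c i ^ α i : ExtendedCentroid R).2
    (MaxRightQuotientRing.of R b)
  change _ * centroidMonomial c α = centroidMonomial c α * _ at hc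
  rw [polyValue_single, polyValue_single, polyValue_single, map_mul, h, mul_assoc, mul_assoc,
    ← mul_assoc _ _ (centroidMonomial c β), ← hc, mul_assoc]

/-- The ring `R[c₁, …, cₙ]` of all polynomial expressions in `c₁, …, cₙ` with coefficients
in `R`, a subring (in general without identity) of the maximal right ring of quotients. -/
noncomputable def polynomialSubring (c : Fin n → ExtendedCentroid R) :
    NonUnitalSubring (MaxRightQuotientRing R) where
  carrier := Set.range (polyValue c)
  zero_mem' := ⟨0, map_zero _⟩
  add_mem' := by
    rintro _ _ ⟨p, rfl⟩ ⟨q, rfl⟩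
    exact ⟨p + q, map_add _ p q⟩
  neg_mem' := by
    rintro _ ⟨p, rfl⟩
    exact ⟨-p, map_neg _ p⟩
  mul_mem' := by
    rintro _ _ ⟨p, rfl⟩ ⟨q, rfl⟩
    change _ ∈ (polyValue c).range
    induction p using Finsupp.induction_linear with
    | zero => simp
    | add p p' hp hp' =>
      rw [map_add, add_mul]
      exact add_mem hp hp'
    | single α a =>
      induction q using Finsupp.induction_linear with
      | zero => simp
      | add q q' hq hq' =>
        rw [map_add, mul_add]
        exact add_mem hq hq'
      | single β b =>
        rw [polyValue_single_mul]
        exact ⟨_, rfl⟩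

end PolynomialExpressions

/-! A nonzero central element would give `S` an identity, necessarily that of `Q`, so the point is
to exclude `1 ∈ S`. If `1 ∈ S`, the center `K` of `S` is a field containing the `cᵢ`, and `R` may be
replaced by its span over the prime field `F`; clearing denominators keeps it nil and prime. Density
of domains gives, for each `t ∈ K`, a nonzero element of `R` that `t` carries into `R`. Hence every
nonzero ideal `J` of `R` contains a nonzero ideal `J'` with `t J' ⊆ J`, and by simplicity `1` is a
combination of monomials in the `cᵢ` with coefficients in `J`.

The contradiction comes by induction on the number of scalars
(`not_forall_exists_mem_scalarSpan_monomialSpan`), for a weaker property: every `J` of the family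
represents some nonzero element of `K`. With no scalars left, this element lies in the nil ring `R`,
which is absurd.

To drop one of `M` scalars `zᵢ`, expand in terms `∏ cᵢ(zᵢ) y(zᵢ) ^ αᵢ` with `deg cᵢ < deg y`, of
order `∑ αᵢ`. The order belongs to the expansion, not to the element: the `zᵢ` may be algebraically
dependent. If all orders lie within a fixed distance of `k`, division by `y(z₀) ^ k` leaves
monomials in the `M - 1` ratios `y(zᵢ)/y(z₀)`, times scalars from a fixed finite-dimensional space,
which a smaller ideal absorbs.

Orders are steered by powers of a central `w` (`exists_steering_element`,
`algebraMap_pow_mul_mem_adicSpan`). As `deg w ≤ deg y / (M + 1)`, multiplication by `w ^ (M + 1)`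
raises the order by at most `M`. Nilness makes `w` raise it by at least one: modulo polynomials
`pⱼ`, a central `u` is a nilpotent element of `R` plus a part divisible by the `pⱼ`, so a high power
`w` of `u` vanishes to high order at every tuple of the `pⱼ`; for `y = ∏ pⱼ ^ P`, partial fractions
then complete a factor `y` in every term. Both `deg w` and `deg y` grow linearly with the nilpotency
index, so taking many `pⱼ` in advance secures the degree bound. -/

/-! ### Coprime polynomials, partial fractions and division with one carry -/

-- Euclid's argument for infinitely many primes. It is needed because `F` may be finite and `z`
-- algebraic, so linear polynomials do not suffice.
open Polynomial in
theorem exists_pairwise_isCoprime_monic {F K : Type*} [Field F] [Field K] [Algebra F K] (z : K)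
    (n : ℕ) : ∃ (e : ℕ) (p : Fin n → F[X]), 0 < e ∧ (∀ i, (p i).Monic) ∧
      (∀ i, (p i).natDegree = e) ∧ (∀ i, aeval z (p i) ≠ 0) ∧
      Pairwise fun i j => IsCoprime (p i) (p j) := by
  induction n with
  | zero => exact ⟨1, Fin.elim0, one_pos, fun i => i.elim0, fun i => i.elim0, fun i => i.elim0,
      fun i => i.elim0⟩
  | succ n ih =>
    obtain ⟨e, p, he, hm, hd, hz, hp⟩ := ih
    -- The factor `X` keeps the degree positive when there are no `p i` yet.
    set g : F[X] := X * ∏ i, p i with hg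
    have hgm : g.Monic := monic_X.mul (monic_prod_of_monic _ _ fun i _ => hm i)
    have hgd : 0 < g.natDegree := by
      rw [hg, (monic_X).natDegree_mul (monic_prod_of_monic _ _ fun i _ => hm i), natDegree_X]
      omega
    have hpg : ∀ i, p i ∣ g := fun i =>
      (Finset.dvd_prod_of_mem p (Finset.mem_univ i)).trans (dvd_mul_left _ _)
    obtain ⟨q, hqm, hqd, hqz, hqc⟩ : ∃ q : F[X], q.Monic ∧ 0 < q.natDegree ∧ aeval z q ≠ 0 ∧
        ∀ i, IsCoprime (p i) q := by
      have hd1 : (g + 1).natDegree = g.natDegree := by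
        rw [← C_1, natDegree_add_C]
      have hm1 : (g + 1).Monic := by
        refine hgm.add_of_left ?_
        rw [degree_one]
        exact natDegree_pos_iff_degree_pos.1 hgd
      -- If `z` is a root of `g + 1`, then `g * (g + 1) + 1` takes the value `1` there. Both
      -- candidates are `1` modulo every `p i`.
      by_cases h : aeval z (g + 1) = 0
      · refine ⟨g * (g + 1) + 1, (hgm.mul hm1).add_of_left ?_, ?_, ?_, fun i => ?_⟩
        · rw [degree_one, ← natDegree_pos_iff_degree_pos, hgm.natDegree_mul hm1]
          omega
        · rw [← C_1, natDegree_add_C, C_1, hgm.natDegree_mul hm1]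
          omega
        · rw [map_add, map_mul, h, mul_zero, zero_add, map_one]
          exact one_ne_zero
        · obtain ⟨r, hr⟩ := hpg i
          exact ⟨-(r * (g + 1)), 1, by rw [hr]; ring⟩
      · refine ⟨g + 1, hm1, hd1 ▸ hgd, h, fun i => ?_⟩
        obtain ⟨r, hr⟩ := hpg i
        exact ⟨-r, 1, by rw [hr]; ring⟩
    -- Powers equalize the degrees without affecting coprimality.
    refine ⟨e * q.natDegree, Fin.cons (q ^ e) fun i => p i ^ q.natDegree, Nat.mul_pos he hqd,
      ?_, ?_, ?_, ?_⟩
    · refine Fin.cases (hqm.pow e) fun i => (hm i).pow _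
    · refine Fin.cases ?_ fun i => ?_
      · simp [hqm.natDegree_pow]
      · simp [(hm i).natDegree_pow, hd, mul_comm]
    · refine Fin.cases ?_ fun i => ?_
      · simpa using fun h => (hqz h).elim
      · simpa using fun h => (hz i h).elim
    · intro i j
      refine Fin.cases ?_ (fun i => ?_) i <;> refine Fin.cases ?_ (fun j => ?_) j <;> intro hij
      · exact (hij rfl).elim
      · exact (hqc j).symm.pow
      · exact (hqc i).pow
      · exact (hp fun h => hij (congrArg Fin.succ h)).pow

-- Partial fractions of `f / ∏ gᵢ`. The polynomial part is absent because `f` and all the terms have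
-- degree below that of the monic product.
open Polynomial in
theorem exists_sum_mul_prod_erase {F : Type*} [Field F] {ι : Type*} [Fintype ι] [DecidableEq ι]
    (g : ι → F[X]) (hm : ∀ i, (g i).Monic) (hg : Pairwise fun i j => IsCoprime (g i) (g j))
    (f : F[X]) (hf : f.degree < (∏ i, g i).degree) :
    ∃ r : ι → F[X], (∀ i, (r i).degree < (g i).degree) ∧
      f = ∑ i, r i * ∏ j ∈ Finset.univ.erase i, g j := by
  obtain ⟨q, r, hr, h⟩ := eq_quo_mul_prod_add_sum_rem_mul_prod f (s := Finset.univ) (g := g)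
    (fun i _ => hm i) (fun i _ j _ hij => hg hij)
  have hM : (∏ i, g i).Monic := monic_prod_of_monic _ _ fun i _ => hm i
  have hs : (∑ i, r i * ∏ j ∈ Finset.univ.erase i, g j).degree < (∏ i, g i).degree := by
    refine (degree_sum_le _ _).trans_lt ((Finset.sup_lt_iff ?_).2 fun i hi => ?_)
    · exact bot_lt_iff_ne_bot.2 (degree_ne_bot.2 hM.ne_zero)
    · rw [← Finset.mul_prod_erase _ _ hi]
      by_cases h0 : r i = 0
      · rw [h0, zero_mul, degree_zero]
        refine bot_lt_iff_ne_bot.2 (degree_ne_bot.2 ?_)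
        rw [Finset.mul_prod_erase _ _ hi]
        exact hM.ne_zero
      · have hP : (∏ j ∈ Finset.univ.erase i, g j).Monic :=
          monic_prod_of_monic _ _ fun i _ => hm i
        rw [hP.degree_mul, hP.degree_mul]
        have h1 := hr i hi
        rw [degree_eq_natDegree hP.ne_zero]
        rw [degree_eq_natDegree h0, degree_eq_natDegree (hm i).ne_zero] at h1 ⊢
        exact_mod_cast Nat.add_lt_add_right (by exact_mod_cast h1) _
  refine ⟨r, fun i => hr i (Finset.mem_univ i), ?_⟩
  by_cases h0 : q = 0
  · rw [h, h0, zero_mul, zero_add]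
  · exfalso
    have h1 : q * ∏ i, g i = f - ∑ i, r i * ∏ j ∈ Finset.univ.erase i, g j := by
      rw [eq_sub_iff_add_eq, ← h]
    have h2 := (degree_sub_le f (∑ i, r i * ∏ j ∈ Finset.univ.erase i, g j)).trans_lt
      (max_lt hf hs)
    rw [← h1, hM.degree_mul, degree_eq_natDegree h0, degree_eq_natDegree hM.ne_zero] at h2
    have : q.natDegree + (∏ i, g i).natDegree < (∏ i, g i).natDegree := by exact_mod_cast h2
    omega

-- The quotient again has degree below `deg y`, so multiplying a `y`-adic digit by `h` produces at
-- most one carry.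
open Polynomial in
theorem exists_eq_mul_add_of_degree_lt {F : Type*} [Field F] {y c h : F[X]} (hy : y.Monic)
    (hc : c.degree < y.degree) (hh : h.natDegree ≤ y.natDegree) :
    ∃ q r : F[X], q.degree < y.degree ∧ r.degree < y.degree ∧ c * h = q * y + r := by
  refine ⟨c * h /ₘ y, c * h %ₘ y, ?_, degree_modByMonic_lt _ hy, ?_⟩
  · by_cases h0 : c = 0
    · rw [h0, zero_mul, zero_divByMonic, degree_zero]
      exact bot_lt_iff_ne_bot.2 (degree_ne_bot.2 hy.ne_zero)
    refine degree_lt_degree ?_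
    have h1 := natDegree_lt_natDegree h0 hc
    have h2 : (c * h).natDegree ≤ c.natDegree + h.natDegree := natDegree_mul_le
    rw [natDegree_divByMonic _ hy]
    omega
  · rw [mul_comm _ y, add_comm, modByMonic_add_div]

/-! ### Spans of products of polynomial values and their `y`-adic expansions -/

section Spans

open Polynomial

variable {F K ι : Type*} [Field F] [Field K] [Algebra F K] [Fintype ι]

/-- The value `∏ hᵢ(zᵢ)`. -/
noncomputable def prodEval (z : ι → K) (h : ι → F[X]) : K := ∏ i, aeval (z i) (h i)

theorem prodEval_mul (z : ι → K) (g h : ι → F[X]) :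
    prodEval z g * prodEval z h = prodEval z fun i => g i * h i := by
  simp [prodEval, Finset.prod_mul_distrib]

theorem prodEval_add [DecidableEq ι] (z : ι → K) (g h : ι → F[X]) :
    (prodEval z fun i => g i + h i) =
      ∑ s : Finset ι, prodEval z fun i => if i ∈ s then g i else h i := by
  simp only [prodEval, map_add, Finset.prod_add, Finset.powerset_univ]
  refine Finset.sum_congr rfl fun s _ => ?_
  rw [← Finset.prod_mul_prod_compl s fun i => aeval (z i) (if i ∈ s then g i else h i),
    ← Finset.compl_eq_univ_sdiff]
  congr 1
  · exact Finset.prod_congr rfl fun i hi => by rw [if_pos hi]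
  · exact Finset.prod_congr rfl fun i hi => by rw [if_neg (Finset.mem_compl.1 hi)]

variable (F) in
/-- The span of the monomials in the `zᵢ`. -/
noncomputable def monomialSpan (z : ι → K) : Submodule F K :=
  Submodule.span F (Set.range fun α : ι → ℕ => ∏ i, z i ^ α i)

variable (F) in
/-- The span of the values `∏ hᵢ(zᵢ)` with all degrees at most `d`. -/
noncomputable def boxSpan (z : ι → K) (d : ℕ) : Submodule F K :=
  Submodule.span F {x | ∃ h : ι → F[X], (∀ i, (h i).natDegree ≤ d) ∧ prodEval z h = x}

/-- The span of the values `∏ hᵢ(zᵢ)` with all degrees at most `d`, where `hᵢ` is divisible by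
`pᵢ ^ σᵢ` for exponents with `∑ σᵢ ≥ n`. -/
noncomputable def vanishingSpan (z : ι → K) (p : ι → F[X]) (d n : ℕ) : Submodule F K :=
  Submodule.span F {x | ∃ h : ι → F[X], (∀ i, (h i).natDegree ≤ d) ∧
    (∃ σ : ι → ℕ, n ≤ ∑ i, σ i ∧ ∀ i, p i ^ σ i ∣ h i) ∧ prodEval z h = x}

/-- The span of the values `∏ cᵢ(zᵢ) y(zᵢ) ^ αᵢ` with `deg cᵢ < deg y` and `∑ αᵢ ∈ A`. -/
noncomputable def adicSpan (z : ι → K) (y : F[X]) (A : Set ℕ) : Submodule F K :=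
  Submodule.span F {x | ∃ (c : ι → F[X]) (α : ι → ℕ), (∀ i, (c i).degree < y.degree) ∧
    ∑ i, α i ∈ A ∧ (prodEval z fun i => c i * y ^ α i) = x}

theorem boxSpan_mono (z : ι → K) {d d' : ℕ} (h : d ≤ d') : boxSpan F z d ≤ boxSpan F z d' :=
  Submodule.span_mono fun _ ⟨g, hg, hx⟩ => ⟨g, fun i => (hg i).trans h, hx⟩

theorem boxSpan_mul_le (z : ι → K) (d d' : ℕ) :
    boxSpan F z d * boxSpan F z d' ≤ boxSpan F z (d + d') := by
  rw [boxSpan, boxSpan, Submodule.span_mul_span, Submodule.span_le]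
  rintro _ ⟨_, ⟨g, hg, rfl⟩, _, ⟨h, hh, rfl⟩, rfl⟩
  refine Submodule.subset_span ⟨fun i => g i * h i, fun i => ?_, (prodEval_mul z g h).symm⟩
  exact natDegree_mul_le.trans (add_le_add (hg i) (hh i))

theorem one_mem_boxSpan (z : ι → K) (d : ℕ) : (1 : K) ∈ boxSpan F z d :=
  Submodule.subset_span ⟨fun _ => 1, by simp, by simp [prodEval]⟩

theorem boxSpan_pow_le (z : ι → K) (d n : ℕ) : boxSpan F z d ^ n ≤ boxSpan F z (d * n) := by
  induction n with
  | zero =>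
    rw [pow_zero, Submodule.one_le]
    exact one_mem_boxSpan z _
  | succ n ih =>
    rw [pow_succ, mul_add, mul_one]
    exact (mul_le_mul' ih le_rfl).trans (boxSpan_mul_le z _ _)

theorem vanishingSpan_mono (z : ι → K) (p : ι → F[X]) {d d' n n' : ℕ} (h : d ≤ d') (hn : n' ≤ n) :
    vanishingSpan z p d n ≤ vanishingSpan z p d' n' :=
  Submodule.span_mono fun _ ⟨g, hg, ⟨σ, h1, h2⟩, hx⟩ =>
    ⟨g, fun i => (hg i).trans h, ⟨σ, hn.trans h1, h2⟩, hx⟩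

theorem vanishingSpan_le_boxSpan (z : ι → K) (p : ι → F[X]) (d n : ℕ) :
    vanishingSpan z p d n ≤ boxSpan F z d :=
  Submodule.span_mono fun _ ⟨g, hg, _, hx⟩ => ⟨g, hg, hx⟩

theorem vanishingSpan_mul_le (z : ι → K) (p : ι → F[X]) (d d' n n' : ℕ) :
    vanishingSpan z p d n * vanishingSpan z p d' n' ≤ vanishingSpan z p (d + d') (n + n') := by
  rw [vanishingSpan, vanishingSpan, Submodule.span_mul_span, Submodule.span_le]
  rintro _ ⟨_, ⟨g, hg, ⟨σ, h1, h2⟩, rfl⟩, _, ⟨h, hh, ⟨τ, h3, h4⟩, rfl⟩, rfl⟩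
  refine Submodule.subset_span ⟨fun i => g i * h i, fun i => ?_,
    ⟨fun i => σ i + τ i, ?_, fun i => ?_⟩, (prodEval_mul z g h).symm⟩
  · exact natDegree_mul_le.trans (add_le_add (hg i) (hh i))
  · rw [Finset.sum_add_distrib]
    exact add_le_add h1 h3
  · rw [pow_add]
    exact mul_dvd_mul (h2 i) (h4 i)

theorem adicSpan_mono (z : ι → K) (y : F[X]) {A A' : Set ℕ} (h : A ⊆ A') :
    adicSpan z y A ≤ adicSpan z y A' :=
  Submodule.span_mono fun _ ⟨c, α, hc, hα, hx⟩ => ⟨c, α, hc, h hα, hx⟩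

theorem monomialSpan_le_iSup_boxSpan (z : ι → K) :
    monomialSpan F z ≤ ⨆ d, boxSpan F z d := by
  rw [monomialSpan, Submodule.span_le]
  rintro _ ⟨α, rfl⟩
  refine Submodule.mem_iSup_of_mem (∑ i, α i) (Submodule.subset_span
    ⟨fun i => X ^ α i, fun i => ?_, by simp [prodEval]⟩)
  rw [natDegree_X_pow]
  exact Finset.single_le_sum (fun _ _ => Nat.zero_le _) (Finset.mem_univ i)

/-- Splitting every `hᵢ` modulo `pᵢ`. -/
theorem boxSpan_le_sup_vanishingSpan [DecidableEq ι] (z : ι → K) (p : ι → F[X]) {e d : ℕ}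
    (he : 0 < e) (hed : e ≤ d) (hp : ∀ i, (p i).Monic) (hpe : ∀ i, (p i).natDegree = e) :
    boxSpan F z d ≤ boxSpan F z (e - 1) ⊔ vanishingSpan z p d 1 := by
  rw [boxSpan, Submodule.span_le]
  rintro _ ⟨h, hh, rfl⟩
  have key : h = fun i => p i * (h i /ₘ p i) + h i %ₘ p i := by
    funext i
    rw [add_comm, modByMonic_add_div]
  have hr : ∀ i, (h i %ₘ p i).natDegree ≤ e - 1 := fun i => by
    have := natDegree_modByMonic_lt (h i) (hp i) fun h1 => by
      have := hpe i
      rw [h1, natDegree_one] at this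
      omega
    rw [hpe] at this
    omega
  have hq : ∀ i, (p i * (h i /ₘ p i)).natDegree ≤ d := fun i => by
    rw [eq_sub_of_add_eq' (modByMonic_add_div (h i) (p i))]
    refine (natDegree_sub_le _ _).trans (max_le (hh i) ((hr i).trans ?_))
    omega
  rw [key, prodEval_add]
  refine Submodule.sum_mem _ fun s _ => ?_
  obtain rfl | ⟨j, hj⟩ := s.eq_empty_or_nonempty
  · refine Submodule.mem_sup_left (Submodule.subset_span ⟨_, fun i => ?_, rfl⟩)
    simpa using hr i
  -- The coordinate `j ∈ s` contributes one factor `p j`, which is all that vanishing order one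
  -- requires.
  · refine Submodule.mem_sup_right (Submodule.subset_span ⟨_, fun i => ?_,
      ⟨Pi.single j 1, by simp, fun i => ?_⟩, rfl⟩)
    · split_ifs
      · exact hq i
      · exact (hr i).trans (by omega)
    · obtain rfl | hij := eq_or_ne i j
      · simp [hj]
      · simp [hij]

/-- Expanding the product, the subset `s` records the coordinates that carry; each carry raises the
order by one. -/
theorem prodEval_mem_adicSpan [DecidableEq ι] (z : ι → K) {y : F[X]} (g c r : ι → F[X])
    (α : ι → ℕ) (hg : ∀ i, g i = c i * y + r i) (hc : ∀ i, (c i).degree < y.degree)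
    (hr : ∀ i, (r i).degree < y.degree) :
    (prodEval z fun i => g i * y ^ α i) ∈
      adicSpan z y (Set.Icc (∑ i, α i) (∑ i, α i + Fintype.card ι)) := by
  have : (fun i => g i * y ^ α i) = fun i => c i * y ^ (α i + 1) + r i * y ^ α i := by
    funext i
    rw [hg]
    ring
  rw [this, prodEval_add]
  refine Submodule.sum_mem _ fun s _ => Submodule.subset_span
    ⟨fun i => if i ∈ s then c i else r i, fun i => α i + if i ∈ s then 1 else 0, fun i => ?_, ?_, ?_⟩
  · dsimp only
    split_ifs
    · exact hc i
    · exact hr i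
  · rw [Finset.sum_add_distrib, Set.mem_Icc]
    simpa using s.card_le_univ
  · congr 1
    funext i
    by_cases hi : i ∈ s <;> simp [hi]

/-- With remainder zero at `j`, only the subsets containing `j` survive, so at least one carry
occurs. -/
theorem prodEval_mem_adicSpan_succ [DecidableEq ι] (z : ι → K) {y : F[X]} (g c r : ι → F[X])
    (α : ι → ℕ) (hg : ∀ i, g i = c i * y + r i) (hc : ∀ i, (c i).degree < y.degree)
    (hr : ∀ i, (r i).degree < y.degree) (j : ι) (hj : r j = 0) :
    (prodEval z fun i => g i * y ^ α i) ∈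
      adicSpan z y (Set.Icc (∑ i, α i + 1) (∑ i, α i + Fintype.card ι)) := by
  have : (fun i => g i * y ^ α i) = fun i => c i * y ^ (α i + 1) + r i * y ^ α i := by
    funext i
    rw [hg]
    ring
  rw [this, prodEval_add]
  refine Submodule.sum_mem _ fun s _ => ?_
  by_cases hs : j ∈ s
  · refine Submodule.subset_span
      ⟨fun i => if i ∈ s then c i else r i, fun i => α i + if i ∈ s then 1 else 0,
        fun i => ?_, ?_, ?_⟩
    · dsimp only
      split_ifs
      · exact hc i
      · exact hr i
    · rw [Finset.sum_add_distrib, Set.mem_Icc]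
      have := Finset.card_pos.2 ⟨j, hs⟩
      simpa using ⟨Finset.card_pos.1 this, s.card_le_univ⟩
    · congr 1
      funext i
      by_cases hi : i ∈ s <;> simp [hi]
  · have : (prodEval z fun i => if i ∈ s then c i * y ^ (α i + 1) else r i * y ^ α i) = 0 :=
      Finset.prod_eq_zero (Finset.mem_univ j) (by simp [hs, hj])
    rw [this]
    exact zero_mem _

theorem boxSpan_mul_adicSpan_le [DecidableEq ι] (z : ι → K) {y : F[X]} (hy : y.Monic) (N : ℕ) :
    boxSpan F z y.natDegree * adicSpan z y {N} ≤
      adicSpan z y (Set.Icc N (N + Fintype.card ι)) := by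
  rw [boxSpan, adicSpan, Submodule.span_mul_span, Submodule.span_le]
  rintro _ ⟨_, ⟨h, hh, rfl⟩, _, ⟨c, α, hc, hα, rfl⟩, rfl⟩
  obtain rfl : ∑ i, α i = N := hα
  choose q r hq hr hqr using fun i => exists_eq_mul_add_of_degree_lt hy (hc i) (hh i)
  dsimp only
  rw [prodEval_mul]
  have : (fun i => h i * (c i * y ^ α i)) = fun i => (c i * h i) * y ^ α i := by
    funext i
    ring
  rw [this]
  exact prodEval_mem_adicSpan z _ q r α hqr hq hr

theorem monomialSpan_le_iSup_adicSpan [DecidableEq ι] (z : ι → K) {y : F[X]} (hy : y.Monic)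
    (hy0 : 0 < y.natDegree) : monomialSpan F z ≤ ⨆ N, adicSpan z y {N} := by
  -- This span contains `1` and is stable under each `z i`, since carries keep it inside itself;
  -- hence it contains all monomials.
  set V : Submodule F K := ⨆ N, adicSpan z y {N} with hV
  have hcl : ∀ i, ∀ v ∈ V, z i * v ∈ V := fun i v hv => by
    have hz : z i ∈ boxSpan F z y.natDegree := by
      refine Submodule.subset_span ⟨Pi.mulSingle i X, fun j => ?_, ?_⟩
      · obtain rfl | hij := eq_or_ne j i
        · rw [Pi.mulSingle_eq_same, natDegree_X]
          exact hy0
        · simp [Pi.mulSingle_eq_of_ne hij]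
      · rw [prodEval, Finset.prod_eq_single i]
        · simp
        · intro j _ hj
          simp [Pi.mulSingle_eq_of_ne hj]
        · simp
    have h1 : boxSpan F z y.natDegree * V ≤ V := by
      rw [hV, Submodule.mul_iSup, iSup_le_iff]
      intro N
      refine (boxSpan_mul_adicSpan_le z hy N).trans ?_
      rw [adicSpan, Submodule.span_le]
      rintro _ ⟨c, α, hc, -, rfl⟩
      exact Submodule.mem_iSup_of_mem (∑ i, α i) (Submodule.subset_span ⟨c, α, hc, rfl, rfl⟩)
    exact h1 (Submodule.mul_mem_mul hz hv)
  have hone : (1 : K) ∈ V :=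
    Submodule.mem_iSup_of_mem 0 (Submodule.subset_span ⟨fun _ => 1, fun _ => 0, fun _ => by
      rw [degree_one]
      exact natDegree_pos_iff_degree_pos.1 hy0, by simp, by simp [prodEval]⟩)
  let M : Submonoid K :=
    { carrier := {x | ∀ v ∈ V, x * v ∈ V}
      one_mem' := fun v hv => by rwa [one_mul]
      mul_mem' := fun {a b} ha hb v hv => by
        rw [mul_assoc]
        exact ha _ (hb _ hv) }
  rw [monomialSpan, Submodule.span_le]
  rintro _ ⟨α, rfl⟩
  have : ∏ i, z i ^ α i ∈ M := prod_mem fun i _ => pow_mem (show z i ∈ M from hcl i) _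
  simpa using this 1 hone

end Spans

/-! ### Submodules of `S` extended by spaces of central scalars -/

section ScalarSpan

variable {F K S : Type*} [Field F] [Field K] [Algebra F K] [Ring S] [Algebra F S] [Algebra K S]
  [IsScalarTower F K S]

/-- The `F`-span of the elements `v • r` with `r ∈ R` and `v ∈ V`. -/
def scalarSpan (R : Submodule F S) (V : Submodule F K) : Submodule F S :=
  Submodule.map₂ (Algebra.lsmul F F S : K →ₐ[F] Module.End F S).toLinearMap V R

theorem smul_mem_scalarSpan {R : Submodule F S} {V : Submodule F K} {r : S} {v : K}
    (hr : r ∈ R) (hv : v ∈ V) : v • r ∈ scalarSpan R V :=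
  Submodule.apply_mem_map₂ _ hv hr

theorem scalarSpan_le {R X : Submodule F S} {V : Submodule F K} :
    scalarSpan R V ≤ X ↔ ∀ r ∈ R, ∀ v ∈ V, v • r ∈ X :=
  Submodule.map₂_le.trans ⟨fun h r hr v hv => h v hv r hr, fun h v hv r hr => h r hr v hv⟩

theorem scalarSpan_span_le {R X : Submodule F S} {s : Set K}
    (h : ∀ r ∈ R, ∀ v ∈ s, v • r ∈ X) : scalarSpan R (Submodule.span F s) ≤ X := by
  refine scalarSpan_le.2 fun r hr v hv => ?_
  induction hv using Submodule.span_induction with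
  | mem v hv => exact h r hr v hv
  | zero => rw [zero_smul]; exact zero_mem _
  | add v w _ _ hv hw => rw [add_smul]; exact add_mem hv hw
  | smul a v _ hv => rw [smul_assoc]; exact X.smul_mem a hv

theorem scalarSpan_mono {R R' : Submodule F S} {V V' : Submodule F K} (hR : R ≤ R') (hV : V ≤ V') :
    scalarSpan R V ≤ scalarSpan R' V' :=
  Submodule.map₂_le_map₂ hV hR

theorem scalarSpan_sup (R : Submodule F S) (V V' : Submodule F K) :
    scalarSpan R (V ⊔ V') = scalarSpan R V ⊔ scalarSpan R V' :=
  Submodule.map₂_sup_left _ _ _ _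

theorem scalarSpan_iSup {ι : Sort*} (R : Submodule F S) (V : ι → Submodule F K) :
    scalarSpan R (⨆ i, V i) = ⨆ i, scalarSpan R (V i) :=
  Submodule.map₂_iSup_left _ _ _

theorem scalarSpan_mul_le (R R' : Submodule F S) (V V' : Submodule F K) :
    scalarSpan R V * scalarSpan R' V' ≤ scalarSpan (R * R') (V * V') := by
  rw [Submodule.mul_le]
  intro x hx y hy
  have h1 : scalarSpan R V ≤ (scalarSpan (R * R') (V * V')).comap (LinearMap.mulRight F y) := by
    refine scalarSpan_le.2 fun r hr v hv => ?_
    have h2 : scalarSpan R' V' ≤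
        (scalarSpan (R * R') (V * V')).comap (LinearMap.mulLeft F (v • r)) := by
      refine scalarSpan_le.2 fun r' hr' v' hv' => ?_
      rw [Submodule.mem_comap, LinearMap.mulLeft_apply, smul_mul_smul_comm]
      exact smul_mem_scalarSpan (Submodule.mul_mem_mul hr hr') (Submodule.mul_mem_mul hv hv')
    exact h2 hy
  exact h1 hx

theorem scalarSpan_pow_succ_le {R : Submodule F S} (hR : R * R ≤ R) (V : Submodule F K) (n : ℕ) :
    scalarSpan R V ^ (n + 1) ≤ scalarSpan R (V ^ (n + 1)) := by
  induction n with
  | zero => rw [zero_add, pow_one, pow_one]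
  | succ n ih =>
    rw [pow_succ, pow_succ V]
    exact ((mul_le_mul' ih le_rfl).trans (scalarSpan_mul_le _ _ _ _)).trans
      (scalarSpan_mono hR le_rfl)

theorem smul_scalarSpan_subset {R X : Submodule F S} {V : Submodule F K} {a : K}
    (h : ∀ r ∈ R, ∀ v ∈ V, (a * v) • r ∈ X) {x : S} (hx : x ∈ scalarSpan R V) : a • x ∈ X := by
  have h1 : scalarSpan R V ≤ X.comap (Algebra.lsmul F F S a) := by
    refine scalarSpan_le.2 fun r hr v hv => ?_
    change a • v • r ∈ X
    rw [← mul_smul]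
    exact h r hr v hv
  exact h1 hx

theorem le_scalarSpan_scalarSpan (R : Submodule F S) (V V' : Submodule F K) :
    scalarSpan R (V * V') ≤ scalarSpan (scalarSpan R V) V' := by
  rw [Submodule.mul_eq_span_mul_set]
  refine scalarSpan_span_le ?_
  rintro r hr _ ⟨v, hv, v', hv', rfl⟩
  dsimp only
  rw [mul_comm, mul_smul]
  exact smul_mem_scalarSpan (smul_mem_scalarSpan hr hv) hv'

theorem scalarSpan_pow_le (R : Submodule F S) (V : Submodule F K) (n : ℕ) :
    scalarSpan R V ^ n ≤ scalarSpan (R ^ n) (V ^ n) := by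
  induction n with
  | zero =>
    rw [pow_zero, pow_zero, pow_zero, Submodule.one_le, ← one_smul K (1 : S)]
    exact smul_mem_scalarSpan (Submodule.one_le.1 le_rfl) (Submodule.one_le.1 le_rfl)
  | succ n ih =>
    rw [pow_succ, pow_succ R, pow_succ V]
    exact (mul_le_mul' ih le_rfl).trans (scalarSpan_mul_le _ _ _ _)

/-- Scalars are central, so `(v v') (a b) = (v a) (v' b)`: absorbing `V` once lets powers of `J`
absorb powers of `V`. -/
theorem scalarSpan_pow_succ_le_of_le {J R : Submodule F S} (hR : R * R ≤ R) {V : Submodule F K}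
    (h : scalarSpan J V ≤ R) (n : ℕ) : scalarSpan (J ^ (n + 1)) (V ^ (n + 1)) ≤ R := by
  induction n with
  | zero => simpa using h
  | succ n ih =>
    rw [pow_succ J, pow_succ V, Submodule.mul_eq_span_mul_set (V ^ (n + 1))]
    refine scalarSpan_span_le ?_
    rintro r hr _ ⟨v, hv, v', hv', rfl⟩
    dsimp only
    have h1 : J ^ (n + 1) * J ≤ R.comap (Algebra.lsmul F F S (v * v')) := by
      rw [Submodule.mul_le]
      intro a ha b hb
      change (v * v') • (a * b) ∈ R
      rw [← smul_mul_smul_comm]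
      exact hR (Submodule.mul_mem_mul (ih (smul_mem_scalarSpan ha hv))
        (h (smul_mem_scalarSpan hb hv')))
    exact h1 hr

theorem mul_mem_scalarSpan {J R : Submodule F S} {V : Submodule F K} {a x : S} (ha : a ∈ J)
    (hx : x ∈ scalarSpan R V) : a * x ∈ scalarSpan (J * R) V := by
  have h1 : scalarSpan R V ≤ (scalarSpan (J * R) V).comap (LinearMap.mulLeft F a) := by
    refine scalarSpan_le.2 fun r hr v hv => ?_
    rw [Submodule.mem_comap, LinearMap.mulLeft_apply, mul_smul_comm]
    exact smul_mem_scalarSpan (Submodule.mul_mem_mul ha hr) hv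
  exact h1 hx

end ScalarSpan

/-! ### Vanishing from nilpotence, and raising the `y`-adic order -/

section Elimination

open Polynomial

variable {F K S ι : Type*} [Field F] [Field K] [Algebra F K] [Ring S] [Algebra F S] [Algebra K S]
  [IsScalarTower F K S] [Fintype ι]

theorem pow_mem_scalarSpan_vanishingSpan {R : Submodule F S} (hR : R * R ≤ R) (z : ι → K)
    (p : ι → F[X]) {d : ℕ} {x : S} (hx : x ∈ scalarSpan R (vanishingSpan z p d 1)) (n : ℕ) :
    x ^ (n + 1) ∈ scalarSpan R (vanishingSpan z p (d * (n + 1)) (n + 1)) := by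
  induction n with
  | zero => simpa using hx
  | succ n ih =>
    rw [pow_succ]
    refine scalarSpan_mono hR ?_ (scalarSpan_mul_le _ _ _ _ (Submodule.mul_mem_mul ih hx))
    rw [mul_add d (n + 1) 1, mul_one]
    exact vanishingSpan_mul_le z p _ _ _ _

/-- Binomial expansion of the power of a central element that is the sum of a nilpotent element
of `R` and an element whose coefficients vanish at `p`. -/
theorem exists_algebraMap_pow_mem_vanishingSpan {R : Submodule F S} (hR : R * R ≤ R)
    (z : ι → K) (p : ι → F[X]) {d : ℕ} {u : K} {a x : S} (ha : a ∈ R) (hnil : IsNilpotent a)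
    (hx : x ∈ scalarSpan R (vanishingSpan z p d 1)) (hu : algebraMap K S u = a + x) :
    ∃ μ : ℕ, ∀ k, algebraMap K S (u ^ (μ + k)) ∈
      scalarSpan R (vanishingSpan z p (d * (μ + k)) (k + 1)) := by
  obtain ⟨μ, hμ⟩ := hnil
  refine ⟨μ, fun k => ?_⟩
  have hcomm : Commute a x := by
    rw [← sub_eq_iff_eq_add'.2 hu]
    exact (Algebra.commute_algebraMap_right u a).sub_right (Commute.refl a)
  have hapow : ∀ n, a ^ (n + 1) ∈ R := fun n => by
    induction n with
    | zero => simpa using ha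
    | succ n ih =>
      rw [pow_succ]
      exact hR (Submodule.mul_mem_mul ih ha)
  rw [map_pow, hu, hcomm.add_pow]
  refine Submodule.sum_mem _ fun i hi => ?_
  rw [← nsmul_eq_mul']
  refine Submodule.smul_of_tower_mem _ _ ?_
  -- Terms with `i ≥ μ` die by nilpotence; in the others `x` has exponent at least `k + 1`.
  by_cases hiμ : μ ≤ i
  · rw [pow_eq_zero_of_le hiμ hμ, zero_mul]
    exact zero_mem _
  obtain ⟨l, hl⟩ : ∃ l, μ + k - i = l + 1 := ⟨μ + k - i - 1, by omega⟩
  rw [hl]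
  have h1 := pow_mem_scalarSpan_vanishingSpan hR z p hx l
  have h2 : vanishingSpan z p (d * (l + 1)) (l + 1) ≤
      vanishingSpan z p (d * (μ + k)) (k + 1) :=
    vanishingSpan_mono z p (Nat.mul_le_mul_left _ (by omega)) (by omega)
  -- The exponent `0` is separate because `a ^ 0 = 1` need not lie in `R`.
  obtain _ | i := i
  · rw [pow_zero, one_mul]
    exact scalarSpan_mono le_rfl h2 h1
  · exact scalarSpan_mono hR h2 (mul_mem_scalarSpan (hapow i) h1)

/-- In each coordinate, the partial fraction lacks exactly the factor `p (t i) ^ P` of `y`.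
Vanishing of order `n` supplies it in some coordinate, which forces a carry. -/
theorem prodEval_mul_mem_adicSpan [DecidableEq ι] {κ : Type*} [Fintype κ] [DecidableEq κ]
    (z : ι → K) (p : κ → F[X]) (hp : ∀ j, (p j).Monic) {P n d : ℕ} {y : F[X]}
    (hy : y = ∏ j, p j ^ P) (hd : d ≤ y.natDegree) (hn : Fintype.card ι * (P - 1) < n)
    (t : ι → κ) (r : ι → F[X]) (hr : ∀ i, (r i).degree < (p (t i) ^ P).degree) (α : ι → ℕ)
    {v : K} (hv : v ∈ vanishingSpan z (fun i => p (t i)) d n) :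
    (prodEval z fun i => (r i * ∏ j ∈ Finset.univ.erase (t i), p j ^ P) * y ^ α i) * v ∈
      adicSpan z y (Set.Icc (∑ i, α i + 1) (∑ i, α i + Fintype.card ι)) := by
  have hym : y.Monic := hy ▸ monic_prod_of_monic _ _ fun j _ => (hp j).pow P
  induction hv using Submodule.span_induction with
  | zero => rw [mul_zero]; exact zero_mem _
  | add v v' _ _ h h' => rw [mul_add]; exact add_mem h h'
  | smul a v _ h => rw [mul_smul_comm]; exact Submodule.smul_mem _ a h
  | mem v hv =>
    obtain ⟨h, hh, ⟨σ, hσ, hdvd⟩, rfl⟩ := hv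
    -- Pigeonhole: the exponents sum to more than `card ι * (P - 1)`.
    obtain ⟨i₀, -, hi₀⟩ : ∃ i ∈ Finset.univ, P - 1 < σ i := by
      refine Finset.exists_lt_of_sum_lt ?_
      rw [Finset.sum_const, Finset.card_univ, smul_eq_mul]
      exact hn.trans_le hσ
    have hPdvd : p (t i₀) ^ P ∣ h i₀ := (pow_dvd_pow _ (by omega)).trans (hdvd i₀)
    have hE : ∀ j, (∏ j ∈ Finset.univ.erase j, p j ^ P).Monic := fun j =>
      monic_prod_of_monic _ _ fun j _ => (hp j).pow P
    have hyE : ∀ j, y = p j ^ P * ∏ j ∈ Finset.univ.erase j, p j ^ P := fun j => by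
      rw [hy, Finset.mul_prod_erase _ (fun j => p j ^ P) (Finset.mem_univ j)]
    have hlt : ∀ i, (r i * ∏ j ∈ Finset.univ.erase (t i), p j ^ P).degree < y.degree := fun i => by
      rw [hyE (t i), (hE _).degree_mul, (hE _).degree_mul, degree_eq_natDegree (hE (t i)).ne_zero]
      exact WithBot.add_lt_add_right (by simp) (hr i)
    have key : ∀ i, ∃ q s : F[X], q.degree < y.degree ∧ s.degree < y.degree ∧
        (r i * ∏ j ∈ Finset.univ.erase (t i), p j ^ P) * h i = q * y + s ∧ (i = i₀ → s = 0) := by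
      intro i
      by_cases hi : i = i₀
      · subst hi
        obtain ⟨g, hg⟩ := hPdvd
        refine ⟨r i * g, 0, ?_, ?_, ?_, fun _ => rfl⟩
        · have hd' := (hh i).trans hd
          by_cases hr0 : r i * g = 0
          · rw [hr0, degree_zero]
            exact bot_lt_iff_ne_bot.2 (degree_ne_bot.2 hym.ne_zero)
          · refine degree_lt_degree ?_
            have h1 := natDegree_lt_natDegree (left_ne_zero_of_mul hr0) (hr i)
            rw [hg, ((hp _).pow P).natDegree_mul' (right_ne_zero_of_mul hr0)] at hd'
            have h2 : (r i * g).natDegree ≤ (r i).natDegree + g.natDegree := natDegree_mul_le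
            omega
        · rw [degree_zero]
          exact bot_lt_iff_ne_bot.2 (degree_ne_bot.2 hym.ne_zero)
        · conv_rhs => rw [hyE (t i)]
          rw [hg]
          ring
      · obtain ⟨q, s, h1, h2, h3⟩ := exists_eq_mul_add_of_degree_lt hym (hlt i) ((hh i).trans hd)
        exact ⟨q, s, h1, h2, h3, fun h => (hi h).elim⟩
    choose q s hq hs hqs h0 using key
    rw [prodEval_mul]
    have : (fun i => (r i * ∏ j ∈ Finset.univ.erase (t i), p j ^ P) * y ^ α i * h i) =
        fun i => ((r i * ∏ j ∈ Finset.univ.erase (t i), p j ^ P) * h i) * y ^ α i := by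
      funext i
      ring
    rw [this]
    exact prodEval_mem_adicSpan_succ z _ q s α hqs hq hs i₀ (h0 i₀ rfl)

/-- If the central element `w` vanishes to a high order at every tuple of the coprime polynomials
`pⱼ`, multiplication by `w` raises the `y`-adic order, where `y = ∏ pⱼ ^ P`. -/
theorem algebraMap_mul_mem_adicSpan_succ [DecidableEq ι] {κ : Type*} [Fintype κ] [DecidableEq κ]
    {R : Submodule F S} (z : ι → K) (p : κ → F[X]) (hp : ∀ j, (p j).Monic)
    (hpc : Pairwise fun i j => IsCoprime (p i) (p j)) {P n d : ℕ} {y : F[X]}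
    (hy : y = ∏ j, p j ^ P) (hd : d ≤ y.natDegree) (hn : Fintype.card ι * (P - 1) < n) {w : K}
    (hw : ∀ t : ι → κ, algebraMap K S w ∈ scalarSpan R (vanishingSpan z (fun i => p (t i)) d n))
    {N : ℕ} {x : K} (hx : x ∈ adicSpan z y {N}) :
    algebraMap K S (w * x) ∈
      scalarSpan R (adicSpan z y (Set.Icc (N + 1) (N + Fintype.card ι))) := by
  induction hx using Submodule.span_induction with
  | zero => rw [mul_zero, map_zero]; exact zero_mem _
  | add v v' _ _ h h' => rw [mul_add, map_add]; exact add_mem h h'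
  | smul a v _ h =>
    rw [mul_smul_comm]
    change IsScalarTower.toAlgHom F K S (a • (w * v)) ∈ _
    rw [map_smul]
    exact Submodule.smul_mem _ a h
  | mem x hx =>
    obtain ⟨c, α, hc, hα, rfl⟩ := hx
    obtain rfl : ∑ i, α i = N := hα
    choose r hr hcr using fun i => exists_sum_mul_prod_erase (fun j => p j ^ P)
      (fun j => (hp j).pow P) (fun i j hij => (hpc hij).pow) (c i) (hy ▸ hc i)
    -- Choosing one partial fraction in each coordinate gives one term per tuple `t`; to each, the
    -- expression of `w` adapted to that tuple applies.
    have : (prodEval z fun i => c i * y ^ α i) = ∑ t : ι → κ,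
        prodEval z fun i => (r i (t i) * ∏ j ∈ Finset.univ.erase (t i), p j ^ P) * y ^ α i := by
      simp only [prodEval]
      rw [← Fintype.piFinset_univ]
      refine Eq.trans ?_ (Finset.prod_univ_sum (fun _ => Finset.univ) fun i j =>
        aeval (z i) ((r i j * ∏ j ∈ Finset.univ.erase j, p j ^ P) * y ^ α i))
      refine Finset.prod_congr rfl fun i _ => ?_
      rw [← map_sum, ← Finset.sum_mul, ← hcr]
    rw [this, Finset.mul_sum, map_sum]
    refine Submodule.sum_mem _ fun t _ => ?_
    rw [mul_comm, map_mul, ← Algebra.smul_def]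
    exact smul_scalarSpan_subset (fun a ha v hv => smul_mem_scalarSpan ha
      (prodEval_mul_mem_adicSpan z p hp hy hd hn t _ (fun i => hr i (t i)) α hv)) (hw t)

end Elimination

/-! ### Steering the order by powers of `w` -/

section Drive

open Polynomial

variable {F K S ι : Type*} [Field F] [Field K] [Algebra F K] [Ring S] [Algebra F S] [Algebra K S]
  [IsScalarTower F K S] [Fintype ι]

theorem adicSpan_le {z : ι → K} {y : F[X]} {A : Set ℕ} {V : Submodule F K}
    (h : ∀ N ∈ A, adicSpan z y {N} ≤ V) : adicSpan z y A ≤ V := by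
  rw [adicSpan, Submodule.span_le]
  rintro _ ⟨c, α, hc, hα, rfl⟩
  exact h _ hα (Submodule.subset_span ⟨c, α, hc, rfl, rfl⟩)

/-- Allows the terms of an expansion to be treated one order at a time, so that the choice of move
may depend on the order. -/
theorem algebraMap_mul_mem_of_adicSpan {R X : Submodule F S} {z : ι → K} {y : F[X]} {A : Set ℕ}
    {a x : K} (hx : algebraMap K S x ∈ scalarSpan R (adicSpan z y A))
    (h : ∀ N ∈ A, ∀ v ∈ adicSpan z y {N}, ∀ r ∈ R, (a * v) • r ∈ X) :
    algebraMap K S (a * x) ∈ X := by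
  rw [map_mul, ← Algebra.smul_def]
  refine smul_scalarSpan_subset (fun r hr v hv => ?_) hx
  have h1 : adicSpan z y A ≤ X.comap ((LinearMap.toSpanSingleton K S r).restrictScalars F ∘ₗ
      LinearMap.mulLeft F a) := by
    refine adicSpan_le fun N hN v hv => ?_
    simpa using h N hN v hv r hr
  simpa using h1 hv

/-- Steering: `up` raises the `y`-adic order by at least one in one unit of time, while `slow`
raises it by at most `card ι` in `card ι + 1` units of time.  Applying whichever is appropriate
keeps the order within a bounded distance of the time. -/
theorem algebraMap_pow_mul_mem_adicSpan {R : Submodule F S} (hR : R * R ≤ R) (z : ι → K) (y : F[X])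
    {w : K} (up : ∀ N, ∀ x ∈ adicSpan z y {N}, algebraMap K S (w * x) ∈
      scalarSpan R (adicSpan z y (Set.Icc (N + 1) (N + Fintype.card ι))))
    (slow : ∀ k, k ≤ Fintype.card ι → ∀ N, ∀ x ∈ adicSpan z y {N},
      algebraMap K S (w ^ (k + 1) * x) ∈
        scalarSpan R (adicSpan z y (Set.Icc N (N + Fintype.card ι))))
    (k t N : ℕ) (h1 : t ≤ N + Fintype.card ι)
    (h2 : (Fintype.card ι + 1) * N ≤ (Fintype.card ι + 1) * (t + Fintype.card ι) + k)
    (x : K) (hx : x ∈ adicSpan z y {N}) :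
    algebraMap K S (w ^ k * x) ∈ scalarSpan (1 ⊔ R)
      (adicSpan z y {n | t + k ≤ n + Fintype.card ι ∧ n ≤ t + k + 2 * Fintype.card ι}) := by
  set M := Fintype.card ι with hM
  -- The coefficient `1` is admitted because zero moves leave `x` with coefficient `1`.
  have hR1 : R * (1 ⊔ R) ≤ 1 ⊔ R := by
    rw [Submodule.mul_sup, Submodule.mul_one]
    exact sup_le le_sup_right (hR.trans le_sup_right)
  induction k using Nat.strong_induction_on generalizing t N x with
  | _ k ih =>
  -- A move consuming `l + 1` of the `k` remaining factors `w`, followed by induction. The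
  -- invariant: the order `N` trails the time `t` by at most `M`, and leads it by at most `M` plus
  -- what `k` remaining slow units can recover, namely `k / (M + 1)`.
  have step : ∀ (l : ℕ), l + 1 ≤ k → ∀ A : Set ℕ,
      algebraMap K S (w ^ (l + 1) * x) ∈ scalarSpan R (adicSpan z y A) →
      (∀ n ∈ A, t + (l + 1) ≤ n + M ∧
        (M + 1) * n ≤ (M + 1) * (t + (l + 1) + M) + (k - (l + 1))) →
      algebraMap K S (w ^ k * x) ∈ scalarSpan (1 ⊔ R)
        (adicSpan z y {n | t + k ≤ n + M ∧ n ≤ t + k + 2 * M}) := by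
    intro l hl A hA hn
    have : w ^ k * x = w ^ (k - (l + 1)) * (w ^ (l + 1) * x) := by
      rw [← mul_assoc, ← pow_add, Nat.sub_add_cancel hl]
    rw [this]
    refine algebraMap_mul_mem_of_adicSpan hA fun n hnA v hv r hr => ?_
    have h3 := ih (k - (l + 1)) (by omega) (t + (l + 1)) n v hv (hn n hnA).1 (hn n hnA).2
    rw [show t + (l + 1) + (k - (l + 1)) = t + k by omega] at h3
    rw [Algebra.smul_def, Algebra.commutes]
    exact scalarSpan_mono hR1 le_rfl (mul_mem_scalarSpan hr h3)
  -- Speed up unless the order is ahead of the time.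
  by_cases hN : N ≤ t
  · obtain _ | k := k
    · rw [pow_zero, one_mul, Algebra.algebraMap_eq_smul_one]
      refine smul_mem_scalarSpan (Submodule.mem_sup_left (Submodule.one_le.1 le_rfl))
        (adicSpan_mono z y ?_ hx)
      rintro n rfl
      constructor <;> omega
    · refine step 0 (by omega) _ (by simpa using up N x hx) fun n hn => ⟨?_, ?_⟩
      · have := hn.1
        omega
      · refine (Nat.mul_le_mul_left _ (?_ : n ≤ t + (0 + 1) + M)).trans (Nat.le_add_right _ _)
        have := hn.2
        omega
  -- The order is ahead: make a full slow move if enough time remains, otherwise finish with one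
  -- shorter slow move.
  · by_cases hk : M + 1 ≤ k
    · refine step M hk _ (slow M le_rfl N x hx) fun n hn => ⟨?_, ?_⟩
      · have := hn.1
        omega
      · refine (Nat.mul_le_mul_left (M + 1) hn.2).trans ?_
        have : (M + 1) * (t + (M + 1) + M) + (k - (M + 1)) = (M + 1) * (t + M) + k +
          (M + 1) * M := by
          zify [hk]
          ring
        rw [this, mul_add]
        omega
    · have hNt : N ≤ t + M := by
        by_contra hlt
        have := Nat.mul_le_mul_left (M + 1) (show t + M + 1 ≤ N by omega)
        rw [mul_add _ (t + M)] at this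
        omega
      obtain _ | k := k
      · rw [pow_zero, one_mul, Algebra.algebraMap_eq_smul_one]
        refine smul_mem_scalarSpan (Submodule.mem_sup_left (Submodule.one_le.1 le_rfl))
          (adicSpan_mono z y ?_ hx)
        rintro n rfl
        constructor <;> omega
      · refine scalarSpan_mono le_sup_right (adicSpan_mono z y fun n hn => ?_)
          (slow k (by omega) N x hx)
        have h3 := hn.1
        have h4 := hn.2
        constructor <;> omega

end Drive

/-! ### Absorbing scalars and normalizing by `y(z₀)` -/

section Descent

open Polynomial

variable {F K S : Type*} [Field F] [Field K] [Algebra F K] [Ring S] [Algebra F S] [Algebra K S]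
  [IsScalarTower F K S]

/-- Absorb the finitely many generators one after another, shrinking the ideal each time. -/
theorem exists_scalarSpan_le_of_fg {𝓙 : Set (Submodule F S)}
    (habs : ∀ J ∈ 𝓙, ∀ t : K, ∃ J' ∈ 𝓙, J' ≤ J ∧ ∀ x ∈ J', t • x ∈ J) {J : Submodule F S}
    (hJ : J ∈ 𝓙) {V : Submodule F K} (hV : V.FG) : ∃ J' ∈ 𝓙, J' ≤ J ∧ scalarSpan J' V ≤ J := by
  classical
  obtain ⟨s, rfl⟩ := hV
  induction s using Finset.induction_on with
  | empty => exact ⟨J, hJ, le_rfl, scalarSpan_span_le (by simp)⟩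
  | insert t s _ ih =>
    obtain ⟨J₁, hJ₁, hle, h⟩ := ih
    obtain ⟨J₂, hJ₂, hle', h'⟩ := habs J₁ hJ₁ t
    refine ⟨J₂, hJ₂, hle'.trans hle, scalarSpan_span_le fun r hr v hv => ?_⟩
    rw [Finset.coe_insert] at hv
    obtain rfl | hv := hv
    · exact hle (h' r hr)
    · exact h (smul_mem_scalarSpan (hle' hr) (Submodule.subset_span hv))

variable (F) in
/-- The span of `1` and the `zᵢ`. -/
def affineSpanOne {ι : Type*} (z : ι → K) : Submodule F K :=
  Submodule.span F (insert 1 (Set.range z))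

theorem one_le_affineSpanOne {ι : Type*} (z : ι → K) : 1 ≤ affineSpanOne F z :=
  Submodule.one_le.2 (Submodule.subset_span (Set.mem_insert _ _))

theorem affineSpanOne_fg {ι : Type*} [Finite ι] (z : ι → K) : (affineSpanOne F z).FG :=
  Submodule.fg_span ((Set.finite_range z).insert 1)

theorem boxSpan_le_affineSpanOne_pow {ι : Type*} [Fintype ι] (z : ι → K) (d : ℕ) :
    boxSpan F z d ≤ affineSpanOne F z ^ (Fintype.card ι * d) := by
  rw [boxSpan, Submodule.span_le]
  rintro _ ⟨h, hh, rfl⟩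
  have h1 : ∀ i, aeval (z i) (h i) ∈ affineSpanOne F z ^ d := fun i => by
    rw [aeval_eq_sum_range]
    refine Submodule.sum_mem _ fun j hj => Submodule.smul_mem _ _ ?_
    have hz : z i ∈ affineSpanOne F z :=
      Submodule.subset_span (Set.mem_insert_of_mem _ (Set.mem_range_self i))
    refine pow_le_pow_right' (one_le_affineSpanOne z) ?_ (Submodule.pow_mem_pow _ hz j)
    have := Finset.mem_range.1 hj
    have := hh i
    omega
  have h2 : ∀ s : Finset ι, ∏ i ∈ s, aeval (z i) (h i) ∈ (affineSpanOne F z ^ d) ^ s.card :=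
    fun s => by
      classical
      induction s using Finset.induction_on with
      | empty => simp
      | insert i s hi ih =>
        rw [Finset.prod_insert hi, Finset.card_insert_of_notMem hi, pow_succ']
        exact Submodule.mul_mem_mul (h1 i) ih
  rw [mul_comm, pow_mul]
  exact h2 Finset.univ

/-- Writing `y(zᵢ) = y(z₀) · (y(zᵢ)/y(z₀))` leaves the power `∑ αᵢ - k` of `y(z₀)`, confined to a
window independent of `k`. The first two factors of the target therefore form a finite-dimensional
space that does not depend on `k`. -/
theorem prodEval_adic_mem {m : ℕ} (z : Fin (m + 1) → K) {y : F[X]}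
    (hY : aeval (z 0) y ≠ 0) (k a b : ℕ) {x : K}
    (hx : x ∈ adicSpan z y {n | k ≤ n + a ∧ n ≤ k + b}) :
    (aeval (z 0) y ^ k)⁻¹ * x ∈
      affineSpanOne F z ^ ((m + 1) * y.natDegree) *
        Submodule.span F ((fun l : ℤ => aeval (z 0) y ^ l) '' Set.Icc (-(a : ℤ)) b) *
        monomialSpan F fun i : Fin m => aeval (z i.succ) y / aeval (z 0) y := by
  set Y := aeval (z 0) y with hYd
  induction hx using Submodule.span_induction with
  | zero => rw [mul_zero]; exact zero_mem _
  | add v v' _ _ h h' => rw [mul_add]; exact add_mem h h'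
  | smul a v _ h => rw [mul_smul_comm]; exact Submodule.smul_mem _ a h
  | mem x hx =>
    obtain ⟨c, α, hc, ⟨h1, h2⟩, rfl⟩ := hx
    have hprod : (prodEval z fun i => c i * y ^ α i) = prodEval z c *
        (Y ^ ∑ i, α i) * ∏ i : Fin m, (aeval (z i.succ) y / Y) ^ α i.succ := by
      rw [← prodEval_mul z c, mul_assoc]
      congr 1
      rw [prodEval, Fin.prod_univ_succ, Fin.sum_univ_succ, pow_add, mul_assoc, map_pow, ← hYd]
      congr 1
      rw [← Finset.prod_pow_eq_pow_sum, ← Finset.prod_mul_distrib]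
      refine Finset.prod_congr rfl fun i _ => ?_
      rw [map_pow, ← mul_pow, mul_div_cancel₀ _ hY]
    have : (Y ^ k)⁻¹ * (prodEval z fun i => c i * y ^ α i) = prodEval z c *
        (Y ^ ((∑ i, α i : ℕ) - k : ℤ)) * ∏ i : Fin m, (aeval (z i.succ) y / Y) ^ α i.succ := by
      rw [hprod, zpow_sub₀ hY, zpow_natCast, zpow_natCast]
      field_simp
    rw [this]
    refine Submodule.mul_mem_mul (Submodule.mul_mem_mul ?_ (Submodule.subset_span ⟨_, ?_, rfl⟩))
      (Submodule.subset_span ⟨fun i => α i.succ, rfl⟩)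
    · have := boxSpan_le_affineSpanOne_pow z y.natDegree (Submodule.subset_span
        ⟨c, fun i => natDegree_le_natDegree (hc i).le, rfl⟩)
      rwa [Fintype.card_fin] at this
    · rw [Set.mem_Icc]
      constructor <;> omega

end Descent

/-! ### The steering element and the induction on the number of scalars -/

section Descent

open Polynomial

variable {F K S : Type*} [Field F] [Field K] [Algebra F K] [Ring S] [Algebra F S] [Algebra K S]
  [IsScalarTower F K S]

theorem exists_mem_scalarSpan_boxSpan {ι : Type*} [Fintype ι] {J : Submodule F S} {z : ι → K}
    {x : S} (hx : x ∈ scalarSpan J (monomialSpan F z)) :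
    ∃ k, 1 ≤ k ∧ x ∈ scalarSpan J (boxSpan F z k) := by
  have h := scalarSpan_mono le_rfl (monomialSpan_le_iSup_boxSpan z) hx
  rw [scalarSpan_iSup, Submodule.mem_iSup_of_directed _ (Monotone.directed_le fun a b hab =>
    scalarSpan_mono le_rfl (boxSpan_mono z hab))] at h
  obtain ⟨k, hk⟩ := h
  exact ⟨k + 1, by omega, scalarSpan_mono le_rfl (boxSpan_mono z k.le_succ) hk⟩

theorem exists_mem_scalarSpan_adicSpan_Iic {ι : Type*} [Fintype ι] {J : Submodule F S} {z : ι → K}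
    {y : F[X]} (hy : y.Monic) (hy0 : 0 < y.natDegree) {x : S}
    (hx : x ∈ scalarSpan J (monomialSpan F z)) :
    ∃ L, x ∈ scalarSpan J (adicSpan z y (Set.Iic L)) := by
  classical
  have h := scalarSpan_mono le_rfl ((monomialSpan_le_iSup_adicSpan z hy hy0).trans
    (iSup_mono fun L => adicSpan_mono z y (A' := Set.Iic L) (by simp))) hx
  rwa [scalarSpan_iSup, Submodule.mem_iSup_of_directed _ (Monotone.directed_le fun a b hab =>
    scalarSpan_mono le_rfl (adicSpan_mono z y (Set.Iic_subset_Iic.2 hab)))] at h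

/-- The existence of a nonzero central element `w` and a polynomial `y` to which the steering
lemma applies. -/
theorem exists_steering_element {ι : Type*} [Fintype ι] [Nonempty ι]
    {R J J₁ : Submodule F S} (hR : R * R ≤ R) (hnil : ∀ r ∈ R, IsNilpotent r) (hJ : J ≤ R)
    (z : ι → K) (z₀ : K) (hJ₁J : scalarSpan J₁ (affineSpanOne F z) ≤ J)
    {v : K} (hv : v ≠ 0) (hvJ : algebraMap K S v ∈ scalarSpan J₁ (monomialSpan F z)) :
    ∃ (w : K) (y : F[X]), w ≠ 0 ∧ y.Monic ∧ 0 < y.natDegree ∧ aeval z₀ y ≠ 0 ∧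
      (∀ N, ∀ x ∈ adicSpan z y {N}, algebraMap K S (w * x) ∈
        scalarSpan R (adicSpan z y (Set.Icc (N + 1) (N + Fintype.card ι)))) ∧
      ∀ k, k ≤ Fintype.card ι → ∀ N, ∀ x ∈ adicSpan z y {N},
        algebraMap K S (w ^ (k + 1) * x) ∈
          scalarSpan R (adicSpan z y (Set.Icc N (N + Fintype.card ι))) := by
  classical
  obtain ⟨k, hk, hvk⟩ := exists_mem_scalarSpan_boxSpan hvJ
  set M := Fintype.card ι with hM
  have hM0 : 0 < M := Fintype.card_pos
  -- The number of polynomials is fixed before the nilpotency index is known; this size makes `deg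
  -- y` at least `M + 1` times the degree bound for `w`.
  set ρ := k * M * (M + 1) ^ 2 with hρ
  have hρ0 : 0 < ρ := by positivity
  obtain ⟨e, p, he, hpm, hpe, hpz, hpc⟩ := exists_pairwise_isCoprime_monic (F := F) z₀ ρ
  set κ := k * (M * e) with hκ
  have heκ : e ≤ κ := by
    rw [hκ, ← mul_assoc]
    exact Nat.le_mul_of_pos_left _ (by positivity)
  obtain ⟨N, hN⟩ : ∃ N, M * e = N + 1 := Nat.exists_eq_succ_of_ne_zero (by positivity)
  -- Remainders modulo polynomials of degree `e` have total degree at most `M * (e - 1)`. With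
  -- coefficients in `J₁ ^ (M * e)` they lie in `R`, so they are nilpotent.
  have hJN : scalarSpan (J₁ ^ (M * e)) (affineSpanOne F z ^ (M * e)) ≤ R := by
    rw [hN]
    exact scalarSpan_pow_succ_le_of_le hR (hJ₁J.trans hJ) N
  have hJR : J₁ ^ (M * e) ≤ R := fun x hx => by
    have := hJN (smul_mem_scalarSpan hx
      ((one_le_pow_of_one_le' (one_le_affineSpanOne z) _) (Submodule.one_le.1 le_rfl)))
    rwa [one_smul] at this
  have hu : algebraMap K S (v ^ (M * e)) ∈ scalarSpan (J₁ ^ (M * e)) (boxSpan F z κ) := by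
    rw [map_pow]
    exact scalarSpan_mono le_rfl (boxSpan_pow_le z k (M * e))
      (scalarSpan_pow_le _ _ _ (Submodule.pow_mem_pow _ hvk _))
  have hμ : ∀ t : ι → Fin ρ, ∃ μ : ℕ, ∀ l, algebraMap K S ((v ^ (M * e)) ^ (μ + l)) ∈
      scalarSpan R (vanishingSpan z (fun i => p (t i)) (κ * (μ + l)) (l + 1)) := fun t => by
    have h1 := scalarSpan_mono le_rfl (boxSpan_le_sup_vanishingSpan z (fun i => p (t i)) he heκ
      (fun i => hpm _) fun i => hpe _) hu
    rw [scalarSpan_sup] at h1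
    obtain ⟨a, ha, x, hx, hax⟩ := Submodule.mem_sup.1 h1
    have haR : a ∈ R := hJN (scalarSpan_mono le_rfl ((boxSpan_le_affineSpanOne_pow z _).trans
      (pow_le_pow_right' (one_le_affineSpanOne z) (Nat.mul_le_mul_left _ (Nat.sub_le e 1)))) ha)
    exact exists_algebraMap_pow_mem_vanishingSpan hR z _ haR (hnil a haR)
      (scalarSpan_mono hJR le_rfl hx) hax.symm
  choose μf hμf using hμ
  -- One bound for the finitely many tuples. The `M * (μ + 1)` extra factors in `s` make the
  -- vanishing order exceed `M * μ`, as pigeonhole with `P = μ + 1` requires.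
  set μ := Finset.univ.sup μf with hμd
  set s := μ + M * (μ + 1) with hs
  have hw : ∀ t : ι → Fin ρ, algebraMap K S ((v ^ (M * e)) ^ s) ∈
      scalarSpan R (vanishingSpan z (fun i => p (t i)) (κ * s) (M * (μ + 1) + 1)) := fun t => by
    have hle : μf t ≤ μ := Finset.le_sup (Finset.mem_univ t)
    have h1 := hμf t (s - μf t)
    rw [show μf t + (s - μf t) = s by omega] at h1
    exact scalarSpan_mono le_rfl (vanishingSpan_mono z _ le_rfl (by omega)) h1
  have hym : (∏ j, p j ^ (μ + 1)).Monic := monic_prod_of_monic _ _ fun j _ => (hpm j).pow _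
  have hyd : (∏ j, p j ^ (μ + 1)).natDegree = ρ * ((μ + 1) * e) := by
    rw [natDegree_prod_of_monic _ _ fun j _ => (hpm j).pow _]
    simp [(hpm _).natDegree_pow, hpe]
  have hsl : κ * s * (M + 1) ≤ (∏ j, p j ^ (μ + 1)).natDegree := by
    have h1 : s ≤ (M + 1) * (μ + 1) := by
      rw [hs, add_mul]
      omega
    calc κ * s * (M + 1) ≤ κ * ((M + 1) * (μ + 1)) * (M + 1) := by gcongr
      _ = _ := by rw [hyd]; ring
  refine ⟨(v ^ (M * e)) ^ s, ∏ j, p j ^ (μ + 1), by positivity, hym, ?_, ?_, ?_, ?_⟩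
  · rw [hyd]
    positivity
  · rw [map_prod]
    exact Finset.prod_ne_zero_iff.2 fun j _ => by
      rw [map_pow]
      exact pow_ne_zero _ (hpz j)
  · refine fun N x hx => algebraMap_mul_mem_adicSpan_succ z p hpm hpc rfl
      ((Nat.le_mul_of_pos_right _ M.succ_pos).trans hsl) ?_ hw hx
    rw [Nat.add_sub_cancel]
    exact Nat.lt_succ_of_le (Nat.mul_le_mul_left _ μ.le_succ)
  · intro l hl N x hx
    have h1 := scalarSpan_pow_succ_le hR _ l
      (Submodule.pow_mem_pow _ (scalarSpan_mono le_rfl (vanishingSpan_le_boxSpan z _ _ _)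
        (hw fun _ => ⟨0, hρ0⟩)) (l + 1))
    rw [← map_pow] at h1
    have h2 : boxSpan F z (κ * s) ^ (l + 1) ≤ boxSpan F z (∏ j, p j ^ (μ + 1)).natDegree :=
      (boxSpan_pow_le z _ _).trans (boxSpan_mono z
        ((Nat.mul_le_mul_left _ (by omega)).trans hsl))
    rw [mul_comm, map_mul, ← Algebra.smul_def]
    refine smul_scalarSpan_subset (fun r hr b hb => smul_mem_scalarSpan hr ?_) h1
    rw [mul_comm]
    exact boxSpan_mul_adicSpan_le z hym N (Submodule.mul_mem_mul (h2 hb) hx)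

/-- Elimination of one of the scalars. -/
theorem exists_monomialSpan_descent {m : ℕ} {R : Submodule F S} (hR : R * R ≤ R)
    (hnil : ∀ r ∈ R, IsNilpotent r) {𝓙 : Set (Submodule F S)} (hne : 𝓙.Nonempty)
    (hle : ∀ J ∈ 𝓙, J ≤ R) (hmul : ∀ J ∈ 𝓙, J * R ≤ J)
    (habs : ∀ J ∈ 𝓙, ∀ t : K, ∃ J' ∈ 𝓙, J' ≤ J ∧ ∀ x ∈ J', t • x ∈ J) (z : Fin (m + 1) → K)
    (hz : ∀ J ∈ 𝓙, ∃ v : K, v ≠ 0 ∧ algebraMap K S v ∈ scalarSpan J (monomialSpan F z)) :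
    ∃ ζ : Fin m → K, ∀ J ∈ 𝓙, ∃ v : K, v ≠ 0 ∧
      algebraMap K S v ∈ scalarSpan J (monomialSpan F ζ) := by
  obtain ⟨J, hJ⟩ := hne
  obtain ⟨J₁, hJ₁, -, hJ₁J⟩ := exists_scalarSpan_le_of_fg habs hJ (affineSpanOne_fg z)
  obtain ⟨v, hv, hvJ⟩ := hz J₁ hJ₁
  obtain ⟨w, y, hw, hym, hy0, hY, up, slow⟩ := exists_steering_element hR hnil (hle J hJ)
    z (z 0) hJ₁J hv hvJ
  -- From here only `w` and `y` matter: the new scalars must be the same for every ideal of the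
  -- family.
  clear! v J J₁
  set M := Fintype.card (Fin (m + 1)) with hM
  refine ⟨fun i => aeval (z i.succ) y / aeval (z 0) y, fun J hJ => ?_⟩
  -- The window of exponents does not depend on the element of `K` represented by `J'`, so `J'` can
  -- be chosen before that element.
  obtain ⟨J', hJ', -, hJ'J⟩ := exists_scalarSpan_le_of_fg habs hJ
    (((affineSpanOne_fg z).pow ((m + 1) * y.natDegree)).mul (Submodule.fg_span (R := F)
      ((Set.finite_Icc (-(M : ℤ)) (2 * M : ℕ)).image fun l : ℤ => aeval (z 0) y ^ l)))
  obtain ⟨v, hv, hvJ⟩ := hz J' hJ'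
  obtain ⟨L, hL⟩ := exists_mem_scalarSpan_adicSpan_Iic hym hy0 hvJ
  have hJR : J' * (1 ⊔ R) ≤ J' := by
    rw [Submodule.mul_sup, Submodule.mul_one]
    exact sup_le le_rfl (hmul J' hJ')
  -- Orders start between `0` and `L` at time `0`; `(M + 1) * L` units suffice to recover a lead of
  -- `L`.
  have h1 : algebraMap K S (w ^ ((M + 1) * L) * v) ∈ scalarSpan J' (adicSpan z y
      {n | (M + 1) * L ≤ n + M ∧ n ≤ (M + 1) * L + 2 * M}) := by
    refine algebraMap_mul_mem_of_adicSpan hL fun N hN x hx r hr => ?_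
    have h2 := algebraMap_pow_mul_mem_adicSpan hR z y up slow ((M + 1) * L) 0 N (Nat.zero_le _)
      (le_add_left (Nat.mul_le_mul_left _ hN)) x hx
    rw [zero_add] at h2
    rw [Algebra.smul_def, Algebra.commutes]
    exact scalarSpan_mono hJR le_rfl (mul_mem_scalarSpan hr h2)
  refine ⟨(aeval (z 0) y ^ ((M + 1) * L))⁻¹ * (w ^ ((M + 1) * L) * v), by positivity, ?_⟩
  rw [map_mul, ← Algebra.smul_def]
  refine smul_scalarSpan_subset (fun r hr x hx => ?_) h1
  exact scalarSpan_mono hJ'J le_rfl (le_scalarSpan_scalarSpan _ _ _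
    (smul_mem_scalarSpan hr (prodEval_adic_mem z hY _ _ _ hx)))

/-- A nil ring cannot, even up to central multiples, produce the identity by means of finitely
many central scalars that are absorbed by a family of right ideals. -/
theorem not_forall_exists_mem_scalarSpan_monomialSpan {m : ℕ} {R : Submodule F S} (hR : R * R ≤ R)
    (hnil : ∀ r ∈ R, IsNilpotent r) {𝓙 : Set (Submodule F S)} (hne : 𝓙.Nonempty)
    (hle : ∀ J ∈ 𝓙, J ≤ R) (hmul : ∀ J ∈ 𝓙, J * R ≤ J)
    (habs : ∀ J ∈ 𝓙, ∀ t : K, ∃ J' ∈ 𝓙, J' ≤ J ∧ ∀ x ∈ J', t • x ∈ J) [Nontrivial S]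
    (z : Fin m → K) :
    ¬ ∀ J ∈ 𝓙, ∃ v : K, v ≠ 0 ∧ algebraMap K S v ∈ scalarSpan J (monomialSpan F z) := by
  induction m with
  | zero =>
    intro hz
    obtain ⟨J, hJ⟩ := hne
    obtain ⟨v, hv, hvJ⟩ := hz J hJ
    have h1 : scalarSpan J (monomialSpan F z) ≤ J := scalarSpan_span_le <| by
      rintro r hr _ ⟨α, rfl⟩
      simpa using hr
    obtain ⟨n, hn⟩ := hnil _ (hle J hJ (h1 hvJ))
    rw [← map_pow, map_eq_zero] at hn
    exact hv (eq_zero_of_pow_eq_zero hn)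
  | succ m ih =>
    intro hz
    obtain ⟨ζ, hζ⟩ := exists_monomialSpan_descent hR hnil hne hle hmul habs z hz
    exact ih ζ hζ

end Descent

/-! ### Simple rings with identity and nil prime subrings -/

section SimpleRing

theorem monomialSpan_mul_le {F K ι : Type*} [Field F] [Field K] [Algebra F K] [Fintype ι]
    (z : ι → K) : monomialSpan F z * monomialSpan F z ≤ monomialSpan F z := by
  rw [monomialSpan, Submodule.span_mul_span]
  refine Submodule.span_mono ?_
  rintro _ ⟨_, ⟨α, rfl⟩, _, ⟨β, rfl⟩, rfl⟩
  exact ⟨fun i => α i + β i, by simp [pow_add, Finset.prod_mul_distrib]⟩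

theorem one_mem_monomialSpan {F K ι : Type*} [Field F] [Field K] [Algebra F K] [Fintype ι]
    (z : ι → K) : 1 ∈ monomialSpan F z :=
  Submodule.subset_span ⟨0, by simp⟩

theorem one_mem_of_mul_mem {F S : Type*} [Field F] [Ring S] [Algebra F S] [IsSimpleRing S]
    {I : Submodule F S} (hI : I ≠ ⊥) (hl : ∀ s, ∀ x ∈ I, s * x ∈ I)
    (hr : ∀ s, ∀ x ∈ I, x * s ∈ I) : (1 : S) ∈ I := by
  obtain ⟨x, hx, hx0⟩ := I.ne_bot_iff.1 hI
  let T : TwoSidedIdeal S := TwoSidedIdeal.mk' I I.zero_mem I.add_mem I.neg_mem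
    (hl _ _) (hr _ _)
  have hT : ∀ y, y ∈ T ↔ y ∈ I := TwoSidedIdeal.mem_mk' _ _ _ _ _ _
  obtain h | h := eq_bot_or_eq_top T
  · have := (hT x).2 hx
    rw [h, TwoSidedIdeal.mem_bot] at this
    exact (hx0 this).elim
  · rw [← hT, h]
    trivial

/-- The induction applies to the nonzero two-sided ideals of `R`: if the span were all of `S`, each
would generate a nonzero ideal of `S`, which contains `1`. -/
theorem scalarSpan_monomialSpan_ne_top {F K S : Type*} [Field F] [Field K] [Algebra F K] [Ring S]
    [Algebra F S] [Algebra K S] [IsScalarTower F K S] [IsSimpleRing S] {n : ℕ}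
    {R : Submodule F S} (hR : R * R ≤ R) (hnil : ∀ r ∈ R, IsNilpotent r)
    (hprime : ∀ a ∈ R, ∀ b ∈ R, (∀ r ∈ R, a * r * b = 0) → a = 0 ∨ b = 0)
    (habs : ∀ t : K, ∃ x ∈ R, x ≠ 0 ∧ t • x ∈ R) (z : Fin n → K) :
    scalarSpan R (monomialSpan F z) ≠ ⊤ := by
  intro htop
  obtain ⟨x₀, hx₀, hx₀0, -⟩ := habs 0
  refine not_forall_exists_mem_scalarSpan_monomialSpan hR hnil
    (𝓙 := {J | J ≠ ⊥ ∧ J ≤ R ∧ J * R ≤ J ∧ R * J ≤ J})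
    ⟨R, fun h => hx₀0 (by simpa [h] using hx₀), le_rfl, hR, hR⟩ (fun J hJ => hJ.2.1)
    (fun J hJ => hJ.2.2.1) ?_ z ?_
  · rintro J ⟨hJ0, hJR, hJl, hJr⟩ t
    -- Nonzero by primeness: if `x` and `t x` lie in `R` and `y ∈ J`, then `y r x` and `t (y r x) =
    -- (y r) (t x)` lie in `J`, and some `y r x` is nonzero.
    refine ⟨J ⊓ J.comap (Algebra.lsmul F F S t), ⟨?_, inf_le_left.trans hJR, ?_, ?_⟩, inf_le_left,
      fun x hx => hx.2⟩
    · obtain ⟨y, hy, hy0⟩ := J.ne_bot_iff.1 hJ0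
      obtain ⟨x, hx, hx0, htx⟩ := habs t
      obtain ⟨r, hr, hyrx⟩ : ∃ r ∈ R, y * r * x ≠ 0 := by
        by_contra! h
        exact (hprime y (hJR hy) x hx h).elim hy0 hx0
      have hyr := hJl (Submodule.mul_mem_mul hy hr)
      refine (Submodule.ne_bot_iff _).2 ⟨y * r * x, ⟨hJl (Submodule.mul_mem_mul hyr hx), ?_⟩, hyrx⟩
      change t • (y * r * x) ∈ J
      rw [← mul_smul_comm]
      exact hJl (Submodule.mul_mem_mul hyr htx)
    · refine Submodule.mul_le.2 fun x hx r hr => ⟨hJl (Submodule.mul_mem_mul hx.1 hr), ?_⟩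
      change t • (x * r) ∈ J
      rw [← smul_mul_assoc]
      exact hJl (Submodule.mul_mem_mul hx.2 hr)
    · refine Submodule.mul_le.2 fun r hr x hx => ⟨hJr (Submodule.mul_mem_mul hr hx.1), ?_⟩
      change t • (r * x) ∈ J
      rw [← mul_smul_comm]
      exact hJr (Submodule.mul_mem_mul hr hx.2)
  · rintro J ⟨hJ0, hJR, hJl, hJr⟩
    refine ⟨1, one_ne_zero, ?_⟩
    rw [map_one]
    refine one_mem_of_mul_mem ?_ (fun s x hx => ?_) fun s x hx => ?_
    · obtain ⟨y, hy, hy0⟩ := J.ne_bot_iff.1 hJ0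
      refine (Submodule.ne_bot_iff _).2 ⟨y, ?_, hy0⟩
      rw [← one_smul K y]
      exact smul_mem_scalarSpan hy (one_mem_monomialSpan z)
    · have hs : s ∈ scalarSpan R (monomialSpan F z) := htop ▸ Submodule.mem_top
      exact scalarSpan_mono hJr (monomialSpan_mul_le z)
        (scalarSpan_mul_le _ _ _ _ (Submodule.mul_mem_mul hs hx))
    · have hs : s ∈ scalarSpan R (monomialSpan F z) := htop ▸ Submodule.mem_top
      exact scalarSpan_mono hJl (monomialSpan_mul_le z)
        (scalarSpan_mul_le _ _ _ _ (Submodule.mul_mem_mul hx hs))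

theorem Subfield.exists_intCast_mul_eq {K : Type*} [Field K] (a : (⊥ : Subfield K)) :
    ∃ m n : ℤ, (n : K) ≠ 0 ∧ (n : K) * a = m := by
  have ha : (a : K) ∈ Subfield.closure (∅ : Set K) := by
    rw [Subfield.closure_empty]
    exact a.2
  obtain ⟨x, hx, y, hy, hxy⟩ := Subfield.mem_closure_iff.1 ha
  rw [Subring.closure_empty] at hx hy
  obtain ⟨m, rfl⟩ := Subring.mem_bot.1 hx
  obtain ⟨n, rfl⟩ := Subring.mem_bot.1 hy
  by_cases hn : (n : K) = 0
  · exact ⟨0, 1, by simp, by simp [← hxy, hn]⟩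
  · exact ⟨m, n, hn, by rw [← hxy, mul_div_cancel₀ _ hn]⟩

/-- Common denominators: scalars of the prime field are quotients of integers, and `R` is closed
under integer multiples. -/
theorem NonUnitalSubring.exists_intCast_smul_mem {K S : Type*} [Field K] [Ring S] [Algebra K S]
    (R : NonUnitalSubring S) {x : S} (hx : x ∈ Submodule.span (⊥ : Subfield K) (R : Set S)) :
    ∃ n : ℤ, (n : K) ≠ 0 ∧ (n : K) • x ∈ R := by
  have hZ : ∀ (n : ℤ) (y : S), y ∈ R → (n : K) • y ∈ R := fun n y hy => by
    rw [Int.cast_smul_eq_zsmul]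
    exact zsmul_mem hy n
  induction hx using Submodule.span_induction with
  | mem x hx => exact ⟨1, by simp, by simpa using hx⟩
  | zero => exact ⟨1, by simp, by simp⟩
  | add x y _ _ hx hy =>
    obtain ⟨m, hm, hmx⟩ := hx
    obtain ⟨n, hn, hny⟩ := hy
    refine ⟨m * n, by simp [hm, hn], ?_⟩
    rw [smul_add]
    refine add_mem ?_ ?_
    · rw [Int.cast_mul, mul_comm, mul_smul]
      exact hZ _ _ hmx
    · rw [Int.cast_mul, mul_smul]
      exact hZ _ _ hny
  | smul a x _ hx =>
    obtain ⟨k, hk, hkx⟩ := hx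
    obtain ⟨m, n, hn, h⟩ := Subfield.exists_intCast_mul_eq a
    refine ⟨k * n, by simp [hk, hn], ?_⟩
    change _ • (a : K) • x ∈ R
    rw [smul_smul, Int.cast_mul, mul_assoc, h, mul_comm, mul_smul]
    exact hZ _ _ hkx

/-- A simple ring with identity is not generated by a nil prime subring and finitely many central
scalars, provided that each scalar sends a nonzero element of the subring into the subring. -/
theorem NonUnitalSubring.closure_smul_ne_top {K S : Type*} [Field K] [Ring S] [Algebra K S]
    [IsSimpleRing S] (R : NonUnitalSubring S) (hnil : ∀ r ∈ R, IsNilpotent r)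
    (hprime : ∀ a ∈ R, ∀ b ∈ R, (∀ r ∈ R, a * r * b = 0) → a = 0 ∨ b = 0)
    (habs : ∀ t : K, ∃ x ∈ R, x ≠ 0 ∧ t • x ∈ R) {n : ℕ} (c : Fin n → K) :
    AddSubgroup.closure {s | ∃ r ∈ R, ∃ α : Fin n → ℕ, (∏ i, c i ^ α i) • r = s} ≠ ⊤ := by
  intro htop
  have hsub : (R : Set S) ⊆ Submodule.span (⊥ : Subfield K) (R : Set S) := Submodule.subset_span
  refine scalarSpan_monomialSpan_ne_top (F := (⊥ : Subfield K))
    (R := Submodule.span _ (R : Set S)) ?_ ?_ ?_ ?_ c ?_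
  · rw [Submodule.span_mul_span]
    refine Submodule.span_mono ?_
    rintro _ ⟨x, hx, y, hy, rfl⟩
    exact mul_mem hx hy
  · intro r hr
    obtain ⟨k, hk, hkr⟩ := R.exists_intCast_smul_mem hr
    obtain ⟨l, hl⟩ := hnil _ hkr
    rw [smul_pow] at hl
    exact ⟨l, (smul_eq_zero.1 hl).resolve_left (pow_ne_zero _ hk)⟩
  · intro a ha b hb hab
    obtain ⟨k, hk, hka⟩ := R.exists_intCast_smul_mem ha
    obtain ⟨l, hl, hlb⟩ := R.exists_intCast_smul_mem hb
    refine (hprime _ hka _ hlb fun r hr => ?_).imp (fun h => (smul_eq_zero.1 h).resolve_left hk)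
      fun h => (smul_eq_zero.1 h).resolve_left hl
    rw [smul_mul_assoc, smul_mul_assoc, mul_smul_comm, hab r (hsub hr), smul_zero, smul_zero]
  · intro t
    obtain ⟨x, hx, hx0, htx⟩ := habs t
    exact ⟨x, hsub hx, hx0, hsub htx⟩
  · refine top_unique fun s _ => ?_
    have hs : s ∈ AddSubgroup.closure {s | ∃ r ∈ R, ∃ α : Fin n → ℕ, (∏ i, c i ^ α i) • r = s} :=
      htop ▸ AddSubgroup.mem_top s
    refine (AddSubgroup.closure_le (K := (scalarSpan (Submodule.span (⊥ : Subfield K) (R : Set S))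
      (monomialSpan _ c)).toAddSubgroup)).2 ?_ hs
    rintro _ ⟨r, hr, α, rfl⟩
    exact smul_mem_scalarSpan (hsub hr) (Submodule.subset_span ⟨α, rfl⟩)

end SimpleRing

theorem NonUnitalSubring.closure_central_mul_ne_top {S : Type*} [Ring S] [IsSimpleRing S]
    (R : NonUnitalSubring S) (hnil : ∀ r ∈ R, IsNilpotent r)
    (hprime : ∀ a ∈ R, ∀ b ∈ R, (∀ r ∈ R, a * r * b = 0) → a = 0 ∨ b = 0)
    (habs : ∀ t : S, ∃ x ∈ R, x ≠ 0 ∧ t * x ∈ R) {n : ℕ} (c : Fin n → Subring.center S) :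
    AddSubgroup.closure {s | ∃ r ∈ R, ∃ α : Fin n → ℕ,
      ((∏ i, c i ^ α i : Subring.center S) : S) * r = s} ≠ ⊤ := by
  -- An isomorphic copy of the center keeps its field structure apart from its structure as a
  -- subring.
  obtain ⟨K, hK, ⟨φ⟩⟩ : ∃ (K : Type _) (_ : Field K), Nonempty (K ≃+* Subring.center S) :=
    ⟨_, (IsSimpleRing.isField_center S).toField, ⟨RingEquiv.refl _⟩⟩
  let : Algebra K S := ((Subring.center S).subtype.comp (φ : K →+* Subring.center S)).toAlgebra'
    fun t s => (Subring.mem_center_iff.1 (φ t).2 s).symm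
  have hsmul : ∀ (t : K) (s : S), t • s = (φ t : S) * s := fun t s => Algebra.smul_def t s
  have h := R.closure_smul_ne_top hnil hprime (fun t => by simpa only [hsmul] using habs (φ t))
    fun i => φ.symm (c i)
  simpa only [hsmul, map_prod, map_pow, RingEquiv.apply_symm_apply] using h

/-- A nonzero central element of a simple ring with zero left annihilator yields an identity. -/
theorem exists_identity_of_mem_center {T : Type*} [NonUnitalRing T] [IsSimpleRing T]
    (hann : ∀ x : T, (∀ y, x * y = 0) → x = 0) {x : T} (hx : x ∈ NonUnitalSubring.center T)
    (hx0 : x ≠ 0) : ∃ e : T, ∀ y, e * y = y ∧ y * e = y := by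
  have hc : ∀ y, y * x = x * y := NonUnitalSubring.mem_center_iff.1 hx
  let I : TwoSidedIdeal T := TwoSidedIdeal.mk' (Set.range (x * ·)) ⟨0, mul_zero x⟩
    (by rintro _ _ ⟨a, rfl⟩ ⟨b, rfl⟩; exact ⟨a + b, mul_add x a b⟩)
    (by rintro _ ⟨a, rfl⟩; exact ⟨-a, mul_neg x a⟩)
    (by rintro b _ ⟨a, rfl⟩; exact ⟨b * a, by simp only [← mul_assoc, hc]⟩)
    (by rintro _ b ⟨a, rfl⟩; exact ⟨a * b, (mul_assoc x a b).symm⟩)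
  have hI : ∀ y, y ∈ I ↔ ∃ a, x * a = y := TwoSidedIdeal.mem_mk' _ _ _ _ _ _
  have hsurj : ∀ y, ∃ a, x * a = y := by
    obtain h | h := eq_bot_or_eq_top I
    · refine (hx0 (hann x fun y => ?_)).elim
      rw [← TwoSidedIdeal.mem_bot, ← h]
      exact (hI _).2 ⟨y, rfl⟩
    · exact fun y => (hI y).1 (h ▸ trivial)
  obtain ⟨e, he⟩ := hsurj x
  refine ⟨e, fun y => ?_⟩
  obtain ⟨a, rfl⟩ := hsurj y
  exact ⟨by rw [← mul_assoc, hc, he], by rw [← hc, mul_assoc, he]⟩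

/-! ### How `R` sits in its ring of quotients -/

namespace MaxRightQuotientRing

variable {R : Type*} [NonUnitalRing R] [IsPrimeRing R]

theorem of_injective : Function.Injective (of R) := by
  refine (injective_iff_map_eq_zero (of R)).2 fun a ha => ?_
  rw [← map_zero (of R)] at ha
  obtain ⟨L, hL, h⟩ := Quotient.exact ha
  have h0 : ∀ x ∈ L, a * x = 0 := fun x hx => by
    obtain ⟨_, _, h1⟩ := h x hx
    exact h1.trans (zero_mul x)
  by_contra hne
  obtain ⟨r, hr, -⟩ := IsDenseRightIdeal.top.dense a a hne
  obtain ⟨s, hs, hrs⟩ := hL.dense (a * r) r hr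
  exact hs (by rw [mul_assoc, h0 _ hrs])

theorem mk_mul_of (f : DensePartialHom R) {x : R} (hx : x ∈ f.dom) :
    mk f * of R x = of R (f.toHom ⟨x, hx⟩) :=
  mk_eq_of_agree fun r _ _ => f.map_mul ⟨x, hx⟩ r

/-- On the domain of a representative `f` of `q`, the product `q x` is the element `f x` of `R`. -/
theorem eq_zero_of_mul_of_eq_zero {q : MaxRightQuotientRing R} (h : ∀ r, q * of R r = 0) :
    q = 0 := by
  obtain ⟨f⟩ := q
  refine mk_eq_of_agree fun x hx _ => ?_
  refine (of_injective ?_).trans (zero_mul x).symm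
  rw [map_zero, ← mk_mul_of f hx]
  exact h x

theorem exists_mul_of_eq_of [Nontrivial R] (q : MaxRightQuotientRing R) :
    ∃ x y : R, x ≠ 0 ∧ q * of R x = of R y := by
  obtain ⟨f⟩ := q
  obtain ⟨a, ha⟩ := exists_ne (0 : R)
  obtain ⟨r, hr, hrf⟩ := f.isDense.dense a a ha
  exact ⟨a * r, _, hr, mk_mul_of f hrf⟩

theorem of_powSucc (a : R) (k : ℕ) : of R (powSucc a k) = of R a ^ (k + 1) := by
  induction k with
  | zero => rw [zero_add, pow_one]; rfl
  | succ k ih => rw [pow_succ, ← ih, ← map_mul]; rfl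

end MaxRightQuotientRing

/-! ### The ring `R[c₁, …, cₙ]` and the theorem -/

section PolynomialSubring

open MaxRightQuotientRing

variable {R : Type*} [NonUnitalRing R] [IsPrimeRing R] {n : ℕ} (c : Fin n → ExtendedCentroid R)

theorem of_mul_centroidMonomial_mem (a : R) (α : Fin n → ℕ) :
    of R a * centroidMonomial c α ∈ polynomialSubring c :=
  ⟨Finsupp.single α a, polyValue_single c α a⟩

theorem of_mem_polynomialSubring (a : R) : of R a ∈ polynomialSubring c := by
  have h := of_mul_centroidMonomial_mem c a 0
  rwa [show centroidMonomial c 0 = 1 by simp [centroidMonomial], mul_one] at h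

theorem mul_mem_polynomialSubring {q : MaxRightQuotientRing R} (hq : q ∈ polynomialSubring c)
    (i : Fin n) : q * c i ∈ polynomialSubring c := by
  obtain ⟨p, rfl⟩ := hq
  induction p using Finsupp.induction_linear with
  | zero => rw [map_zero, zero_mul]; exact zero_mem _
  | add p p' hp hp' => rw [map_add, add_mul]; exact add_mem hp hp'
  | single α a =>
    rw [polyValue_single, mul_assoc]
    have h : centroidMonomial c α * c i = centroidMonomial c (α + Pi.single i 1) := by
      simp only [centroidMonomial, Pi.add_apply, pow_add, Finset.prod_mul_distrib]
      rw [Finset.prod_eq_single (f := fun j => c j ^ (Pi.single i 1 : Fin n → ℕ) j) i]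
      · simp
      · intro j _ hj
        simp [hj]
      · simp
    rw [h]
    exact of_mul_centroidMonomial_mem c a _

/-- With an identity, the ring contains the `cᵢ` as central elements and is generated additively by
monomials in them times the image of `R`, so the result for simple rings with identity applies. -/
theorem one_notMem_polynomialSubring (hnil : IsNilRing R)
    (hsimple : IsSimpleRing (polynomialSubring c)) : 1 ∉ polynomialSubring c := by
  intro h1
  let T : Subring (MaxRightQuotientRing R) := (polynomialSubring c).toSubring h1
  have hT : ∀ q, q ∈ T ↔ q ∈ polynomialSubring c := fun _ => Iff.rfl
  have : IsSimpleRing T := hsimple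
  have : Nontrivial R := by
    by_contra h
    rw [not_nontrivial_iff_subsingleton] at h
    obtain ⟨x, hx⟩ := exists_ne (0 : T)
    refine hx (Subtype.ext (eq_zero_of_mul_of_eq_zero fun r => ?_))
    rw [Subsingleton.elim r 0, map_zero, mul_zero]
  let γ : Fin n → Subring.center T := fun i =>
    ⟨⟨c i, (hT _).2 (by simpa using mul_mem_polynomialSubring c h1 i)⟩,
      Subring.mem_center_iff.2 fun q => Subtype.ext (Subring.mem_center_iff.1 (c i).2 q)⟩
  have hγ : ∀ α : Fin n → ℕ, (((∏ i, γ i ^ α i : Subring.center T) : T) :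
      MaxRightQuotientRing R) = centroidMonomial c α := fun α => by
    have h2 : ∀ s : Finset (Fin n), (((∏ i ∈ s, γ i ^ α i : Subring.center T) : T) :
        MaxRightQuotientRing R) = (∏ i ∈ s, c i ^ α i : ExtendedCentroid R) := fun s => by
      classical
      induction s using Finset.induction_on with
      | empty => simp
      | insert i s hi ih =>
        rw [Finset.prod_insert hi, Finset.prod_insert hi]
        push_cast
        rw [ih]
    exact h2 Finset.univ
  let R' : NonUnitalSubring T :=
    { carrier := {x | ∃ r, of R r = x}
      zero_mem' := ⟨0, map_zero _⟩
      add_mem' := by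
        rintro x y ⟨a, ha⟩ ⟨b, hb⟩
        exact ⟨a + b, by rw [map_add, ha, hb]; rfl⟩
      neg_mem' := by
        rintro x ⟨a, ha⟩
        exact ⟨-a, by rw [map_neg, ha]; rfl⟩
      mul_mem' := by
        rintro x y ⟨a, ha⟩ ⟨b, hb⟩
        exact ⟨a * b, by rw [map_mul, ha, hb]; rfl⟩ }
  let i : R → T := fun r => ⟨of R r, of_mem_polynomialSubring c r⟩
  have hi : ∀ r, i r ∈ R' := fun r => ⟨r, rfl⟩
  have hi0 : ∀ r, i r = 0 → r = 0 := fun r hr => of_injective <| by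
    rw [map_zero]
    exact congrArg Subtype.val hr
  have hR' : ∀ x ∈ R', ∃ r, i r = x := fun x ⟨r, hr⟩ => ⟨r, Subtype.ext hr⟩
  refine R'.closure_central_mul_ne_top ?_ ?_ ?_ γ ?_
  · intro x hx
    obtain ⟨r, rfl⟩ := hR' x hx
    obtain ⟨k, hk⟩ := hnil r
    refine ⟨k + 1, Subtype.ext ?_⟩
    change of R r ^ (k + 1) = 0
    rw [← of_powSucc, hk, map_zero]
  · intro x hx y hy h
    obtain ⟨a, rfl⟩ := hR' x hx
    obtain ⟨b, rfl⟩ := hR' y hy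
    refine (IsPrimeRing.eq_zero_or_eq_zero a b fun r => of_injective ?_).imp ?_ ?_
    · rw [map_zero, map_mul, map_mul]
      exact congrArg Subtype.val (h (i r) (hi r))
    · rintro rfl
      exact Subtype.ext (map_zero _)
    · rintro rfl
      exact Subtype.ext (map_zero _)
  · intro t
    obtain ⟨x, y, hx, hxy⟩ := exists_mul_of_eq_of (t : MaxRightQuotientRing R)
    exact ⟨i x, hi x, fun h => hx (hi0 x h), y, hxy.symm⟩
  · refine top_unique fun s _ => ?_
    obtain ⟨p, hp⟩ : ∃ p, polyValue c p = s := s.2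
    induction p using Finsupp.induction_linear generalizing s with
    | zero =>
      rw [show s = 0 from Subtype.ext (hp.symm.trans (map_zero _))]
      exact AddSubgroup.zero_mem _
    | add p q ihp ihq =>
      rw [show s = ⟨polyValue c p, p, rfl⟩ + ⟨polyValue c q, q, rfl⟩ from
        Subtype.ext (hp.symm.trans (map_add _ p q))]
      exact AddSubgroup.add_mem _ (ihp _ trivial rfl) (ihq _ trivial rfl)
    | single α a =>
      refine AddSubgroup.subset_closure ⟨i a, hi a, α, Subtype.ext ?_⟩
      rw [← hp, polyValue_single, Subring.coe_mul, hγ]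
      exact (Subring.mem_center_iff.1 (∏ i, c i ^ α i : ExtendedCentroid R).2 (of R a)).symm

end PolynomialSubring

theorem theorem1 {R : Type*} [NonUnitalRing R] [IsPrimeRing R] (hnil : IsNilRing R)
    (n : ℕ) (hn : 1 ≤ n) (c : Fin n → ExtendedCentroid R)
    (hsimple : IsSimpleRing (polynomialSubring c)) :
    NonUnitalSubring.center (polynomialSubring c) = ⊥ ∧
      ¬ ∃ e : polynomialSubring c, ∀ x : polynomialSubring c, e * x = x ∧ x * e = x := by
  have hid : ¬ ∃ e : polynomialSubring c, ∀ x : polynomialSubring c, e * x = x ∧ x * e = x := by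
    rintro ⟨e, he⟩
    refine one_notMem_polynomialSubring c hnil hsimple ?_
    -- An identity of `S` fixes the image of `R`, so `e - 1` annihilates it from the left and `e` is
    -- the identity of `Q`.
    have h1 : (e : MaxRightQuotientRing R) - 1 = 0 :=
      MaxRightQuotientRing.eq_zero_of_mul_of_eq_zero fun r => by
        rw [sub_mul, one_mul, sub_eq_zero]
        exact congrArg Subtype.val (he ⟨_, of_mem_polynomialSubring c r⟩).1
    exact sub_eq_zero.1 h1 ▸ e.2
  refine ⟨eq_bot_iff.2 fun x hx => ?_, hid⟩
  by_contra hx0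
  refine hid (exists_identity_of_mem_center (fun y hy => Subtype.ext ?_) hx fun h => hx0 ?_)
  · exact MaxRightQuotientRing.eq_zero_of_mul_of_eq_zero fun r =>
      congrArg Subtype.val (hy ⟨_, of_mem_polynomialSubring c r⟩)
  · rw [h]
    exact zero_mem _
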